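/- **Setting.** Let $\mathcal V$ be a finite set of users, $\mathcal B\subseteq\mathcal V$ a set of broadcasters, $\mathcal E\subseteq\mathcal V\times\mathcal V$ a set of existing links and $\mathcal E'\subseteq\mathcal B\times\mathcal V$ a set of candidate links with $\mathcal E'\cap\mathcal E=\emptyset$; a link $(i,j)$ means that $j$ follows $i$. Let $\mathcal V'\subseteq\mathcal V$ be the set of users that occur in some link of $\mathcal E'$. Let $0\le t_0<t_f$. In the time window $[0,t_f]$, broadcaster $i\in\mathcal B$ posts stories according to a Poisson process with (nonnegative, integrable) intensity $\mu_i(t)$, and user $j$ receives stories through the links $\mathcal E$ according to a Poisson process with (nonnegative, integrable) intensity $\gamma_{j|\mathcal E}(t)$. The posting processes of the broadcasters are mutually independent, and for each $j$ the process of stories that $j$ receives through $\mathcal E$ is independent of the posting processes of the broadcasters $i$ with $(i,j)\in\mathcal E'$. For $\mathcal E_{\mathcal B}\subseteq\mathcal E'$, the feed of user $j$ consists of the stories received through $\mathcal E$ together with those posted by the broadcasters $i$ with $(i,j)\in\mathcal E_{\mathcal B}$, in inverse chronological order; its intensity is $\gamma_j(t)=\gamma_{j|\mathcal E}(t)+\sum_{i\in\mathcal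 B:(i,j)\in\mathcal E_{\mathcal B}}\mu_i(t)$. Let $r(t,i,j)$ be the number of stories of $i$ among the top $K$ positions of the feed of $j$ at time $t$. The average top $K$ visibility is $$F(\mathcal E_{\mathcal B})=\sum_{j\in\mathcal V'}\ \sum_{i\in\mathcal B:(i,j)\in\mathcal E_{\mathcal B}}\mathbb E\Big[\int_{t_0}^{t_f}r(t,i,j)\,dt\Big].$$ The generalized curvature of a set function $F$ on the subsets of a finite set $W$ is the smallest $\alpha\le1$ such that $F(A\cup\{v\})-F(A)\ge(1-\alpha)\,\big(F(B\cup\{v\})-F(B)\big)$ for all $v\in W$ and $A\subseteq B\subseteq W$ (read as $-\infty$ if every $\alpha\le1$ has this property). A function $\lambda$ is $\xi$-bounded if $\sup_{(0,t_f)}\lambda\le\xi\inf_{(0,t_f)}\lambda$. **Theorem.** Let $K\ge2$, $\zeta>4e^{7/4}$ and $\rho>0$. Suppose that 1. for every $\mathcal E_{\mathcal B}\subseteq\mathcal E'$ and every user $j\in\mathcal V$, the feed intensity $\gamma_j$ is $\xi$-bounded; 2. $\int_0^{t_0}\gamma_{j|\mathcal E}(x)\,dx\ge K-1+\zeta\sqrt{K-1}$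 for every $j\in\mathcal V$; 3. $\mu_i(t)\le\dfrac{\gamma_{j|\mathcal E}(t)}{\rho\sqrt{K-1}}$ for all $t\in[0,t_f]$, $i\in\mathcal B$ and $j\in\mathcal V'$. Then the generalized curvature $\alpha$ of the average visibility $F$ on the ground set $\mathcal E'$ satisfies $$\alpha\le\alpha^*=1-\frac1{\xi\,\theta_2},\qquad \theta_2=\frac{2e^{7/4}}{\big(1-\frac{4e^{7/4}}{\zeta}\big)\min\{\rho,1\}\,e^{-1/\rho^2}}\,\xi+1 ,$$ that is, $F(A\cup\{v\})-F(A)\ge\frac1{\xi\theta_2}\big(F(B\cup\{v\})-F(B)\big)$ for all $v\in\mathcal E'$ and $A\subseteq B\subseteq\mathcal E'$. The bound does not depend on $K$. -/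

import Mathlib

open MeasureTheory ProbabilityTheory Set
open scoped NNReal ENNReal

noncomputable section

/-! ### Generalized curvature of a set function -/

/-- The marginal gain `F (S ∪ {v}) - F S`. -/
def marginalGain {α : Type*} [DecidableEq α] (F : Finset α → ℝ) (v : α) (S : Finset α) : ℝ :=
  F (S ∪ {v}) - F S

/-- The inequality defining `a`-submodularity of `F` on the ground set `W`. -/
def IsAlphaSubmodular {α : Type*} [DecidableEq α] (W : Finset α) (F : Finset α → ℝ) (a : ℝ) :
    Prop :=
  ∀ v ∈ W, ∀ A B : Finset α, A ⊆ B → B ⊆ W →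
    (1 - a) * marginalGain F v B ≤ marginalGain F v A

/-- The smallest `a ≤ 1` for which `F` is `a`-submodular. It is taken in the extended reals, so
that it is `⊤` if there is no such `a` and `⊥` if every real `a ≤ 1` will do (constant `F`). -/
def generalizedCurvature {α : Type*} [DecidableEq α] (W : Finset α) (F : Finset α → ℝ) : EReal :=
  sInf ((fun a : ℝ => (a : EReal)) '' {a : ℝ | a ≤ 1 ∧ IsAlphaSubmodular W F a})

/-! ### Poisson processes on a time window `[0, T]` -/

/-- Number of points of the random set `S` in `A`. -/
def pointCount {Ω : Type*} (S : Ω → Set ℝ) (A : Set ℝ) (ω : Ω) : ℕ∞ :=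
  (S ω ∩ A).encard

/-- An intensity on `[0, T]`: nonnegative and integrable there. -/
structure IsIntensity (T : ℝ) (lam : ℝ → ℝ) : Prop where
  nonneg : ∀ x ∈ Icc 0 T, 0 ≤ lam x
  integrable : IntegrableOn lam (Icc 0 T)

/-- `S` is a Poisson process on `[0, T]` with intensity `lam`: the number of points in a Borel set
`A ⊆ [0, T]` is Poisson distributed with mean `∫_A lam`, and the numbers of points in finitely many
pairwise disjoint Borel sets are independent. -/
structure IsPoissonProcess {Ω : Type*} [MeasurableSpace Ω] (P : Measure Ω) (T : ℝ) (lam : ℝ → ℝ)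
    (S : Ω → Set ℝ) : Prop where
  measurable_count : ∀ A : Set ℝ, MeasurableSet A → A ⊆ Icc 0 T → Measurable (pointCount S A)
  count_law : ∀ A : Set ℝ, MeasurableSet A → A ⊆ Icc 0 T → ∀ n : ℕ,
    P {ω | pointCount S A ω = (n : ℕ∞)} = poissonMeasure (∫ x in A, lam x).toNNReal {n}
  indep_count : ∀ (n : ℕ) (A : Fin n → Set ℝ), (∀ k, MeasurableSet (A k)) →
    (∀ k, A k ⊆ Icc 0 T) → (∀ k l, k ≠ l → Disjoint (A k) (A l)) →
    iIndepFun (fun k => pointCount S (A k)) P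

/-- The σ-algebra generated by the numbers of points of `S` in the Borel subsets of `[0, T]`. -/
abbrev pointSigma {Ω : Type*} (T : ℝ) (S : Ω → Set ℝ) : MeasurableSpace Ω :=
  ⨆ A : {A : Set ℝ // MeasurableSet A ∧ A ⊆ Icc 0 T},
    MeasurableSpace.comap (pointCount S A.1) ⊤

/-! ### Social network, feeds and visibility -/

/-- A social network with existing links `links`, broadcasters `bc` and candidate links `cand`
from broadcasters to users; a link `(i, j)` means that `j` follows `i`. The stories posted by
broadcaster `i` in `[0, T]` form a Poisson process `post i` with intensity `mu i`. The stories that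
`j` receives in `[0, T]` from those she follows through the existing links form a Poisson process
`recv j` with intensity `gamma j`. Different broadcasters post independently, and `recv j` is
independent of the posts of the broadcasters that `j` could gain through candidate links. -/
structure FeedModel (V : Type*) [Fintype V] [DecidableEq V] {Ω : Type*} [MeasurableSpace Ω]
    (P : Measure Ω) (T : ℝ) where
  links : Finset (V × V)
  cand : Finset (V × V)
  disjoint_links : Disjoint cand links
  bc : Finset V
  source_mem : ∀ e ∈ cand, e.1 ∈ bc
  mu : V → ℝ → ℝ
  gamma : V → ℝ → ℝ
  post : V → Ω → Set ℝ
  recv : V → Ω → Set ℝ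
  mu_intensity : ∀ i ∈ bc, IsIntensity T (mu i)
  gamma_intensity : ∀ j, IsIntensity T (gamma j)
  post_poisson : ∀ i ∈ bc, IsPoissonProcess P T (mu i) (post i)
  recv_poisson : ∀ j, IsPoissonProcess P T (gamma j) (recv j)
  indep_post : iIndep (fun i : {i // i ∈ bc} => pointSigma T (post i.1)) P
  indep_recv : ∀ j, Indep (pointSigma T (recv j))
    (⨆ i : {i // (i, j) ∈ cand}, pointSigma T (post i.1)) P

namespace FeedModel

variable {V : Type*} [Fintype V] [DecidableEq V] {Ω : Type*} [MeasurableSpace Ω]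
  {P : Measure Ω} {T : ℝ}

/-- The broadcasters that `j` gains through the links `L`. -/
def gained (m : FeedModel V P T) (L : Finset (V × V)) (j : V) : Finset V :=
  m.bc.filter (fun i => (i, j) ∈ L)

/-- The users that occur in the candidate links. -/
def candUsers (m : FeedModel V P T) : Finset V :=
  m.cand.image Prod.fst ∪ m.cand.image Prod.snd

/-- The intensity of the feed of `j` once the links `L` are added. -/
def feedIntensity (m : FeedModel V P T) (L : Finset (V × V)) (j : V) (t : ℝ) : ℝ :=
  m.gamma j t + ∑ i ∈ m.gained L j, m.mu i t

/-- The number of stories that arrive during `A` in the feed of `j` once the links `L` are added. -/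
def feedCount (m : FeedModel V P T) (L : Finset (V × V)) (j : V) (A : Set ℝ) (ω : Ω) : ℕ∞ :=
  pointCount (m.recv j) A ω + ∑ i ∈ m.gained L j, pointCount (m.post i) A ω

/-- The number of stories posted by `i` that are among the top `K` positions of the feed of `j` at
time `t`, in inverse chronological order and with the links `L` added: a story posted at time `τ` is
there if fewer than `K` stories arrived in the feed after `τ` and up to time `t`. -/
def topCount (m : FeedModel V P T) (K : ℕ) (L : Finset (V × V)) (i j : V) (t : ℝ) (ω : Ω) : ℕ∞ :=
  {τ : ℝ | τ ∈ m.post i ω ∧ τ ∈ Icc 0 t ∧ m.feedCount L j (Ioc τ t) ω < (K : ℕ∞)}.encard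

/-- The expected top `K` visibility of `i` with respect to `j` over `[t₀, T]`. -/
def linkVisibility (m : FeedModel V P T) (K : ℕ) (t₀ : ℝ) (L : Finset (V × V)) (i j : V) : ℝ :=
  (∫⁻ ω, (∫⁻ t in Icc t₀ T, (m.topCount K L i j t ω : ℝ≥0∞)) ∂P).toReal

/-- The average top `K` visibility of the broadcasters with respect to the followers induced by
the links `L`, over the observation window `[t₀, T]`. -/
def visibility (m : FeedModel V P T) (K : ℕ) (t₀ : ℝ) (L : Finset (V × V)) : ℝ :=
  ∑ j ∈ m.candUsers, ∑ i ∈ m.gained L j, m.linkVisibility K t₀ L i j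

end FeedModel

/-- `sup lam ≤ ξ * inf lam` over the open interval `(0, T)`, written out pointwise. -/
def IsXiBounded (T : ℝ) (ξ : ℝ) (lam : ℝ → ℝ) : Prop :=
  ∀ s ∈ Ioo 0 T, ∀ t ∈ Ioo 0 T, lam s ≤ ξ * lam t

/-- The constant `θ₂`. -/
def theta₂ (ξ ζ ρ : ℝ) : ℝ :=
  2 * Real.exp (7 / 4) /
    ((1 - 4 * Real.exp (7 / 4) / ζ) * min ρ 1 * Real.exp (-(1 / ρ ^ 2))) * ξ + 1

end

/-!
The curvature of the visibility is controlled by `ξ` alone: a marginal gain in a large set of links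
is at most `ξ ^ 2` times that in a smaller one, and `ξ ^ 2 ≤ ξ * theta₂ ξ ζ ρ`.

*Reduction to intensities.* The stories that reach `j` through the links `L` are a superposition of
independent Poisson processes, of intensity `lam = gam + M`, where `gam` is the intensity of the
received stories and `M` the sum of those of the gained broadcasters. A post of time `τ` is still
visible at time `t` if a Poisson variable of mean `∫ x in τ..t, lam x` is less than `K`; call the
probability `Q (∫ x in τ..t, lam x)`. By Campbell's formula (`lintegral_topPosts`, obtained by
discretizing time) the expected number of visible posts at time `t` is
`visibleMean Q M lam t = ∫ τ in 0..t, M τ * Q (∫ x in τ..t, lam x)`, and Tonelli's theorem turns the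
visibility into an integral of this over `t` (`sum_linkVisibility_eq`).

*The gain at a fixed time.* Only two properties of `Q` matter: it decreases and is nonnegative.
Substituting `u = ∫ x in τ..t, g x` gives `visibleMean Q g g t = ∫ u in 0..∫ g, Q u`, which depends
only on the total mass of `g`. Hence the gain from a further intensity `m` is `G + D`
(`visibleGain_eq`), where `G` is the integral of `Q` from `∫ lam` to `∫ (lam + m)` and `D` is the
loss of visibility of the received stories. Let `E` be the corresponding loss for the whole feed
`lam`; then `G + E = visibleMean Q m (lam + m) t`. Both `G` and `G + E` decrease when `lam` grows.
If `k * lam ≤ gam` with `0 ≤ k ≤ 1`, then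
`G + D ≥ G + k * E = (1 - k) * G + k * (G + E)` is therefore at least the value of `G + k * E` in
any thicker feed, and if the share of `gam` there is at most `ξ ^ 2 * k`, this is at least `ξ⁻²`
times the gain there (`visibleGain_le_mul`). As `gam` and `lam` are `ξ`-bounded, `k = inf gam / sup lam`
has both properties (`IsXiBounded.exists_share`).
-/

noncomputable section

/-! ### Expected visibility as a functional of the intensities -/

lemma LipschitzOnWith.comp_absolutelyContinuousOnInterval {R f : ℝ → ℝ} {s : Set ℝ} {C : ℝ≥0}
    {a b : ℝ} (hR : LipschitzOnWith C R s) (hf : AbsolutelyContinuousOnInterval f a b)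
    (hs : MapsTo f (uIcc a b) s) : AbsolutelyContinuousOnInterval (fun x => R (f x)) a b := by
  rw [absolutelyContinuousOnInterval_iff] at hf ⊢
  intro ε hε
  obtain ⟨δ, hδ, h⟩ := hf (ε / (C + 1)) (by positivity)
  refine ⟨δ, hδ, fun E hE hlt => ?_⟩
  have hlt' := h E hE hlt
  calc ∑ i ∈ Finset.range E.1, dist (R (f (E.2 i).1)) (R (f (E.2 i).2))
      ≤ ∑ i ∈ Finset.range E.1, C * dist (f (E.2 i).1) (f (E.2 i).2) :=
        Finset.sum_le_sum fun i hi =>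
          hR.dist_le_mul _ (hs (hE.1 i hi).1) _ (hs (hE.1 i hi).2)
    _ = C * ∑ i ∈ Finset.range E.1, dist (f (E.2 i).1) (f (E.2 i).2) := by
        rw [Finset.mul_sum]
    _ ≤ (C + 1) * ∑ i ∈ Finset.range E.1, dist (f (E.2 i).1) (f (E.2 i).2) := by
        gcongr
        simp
    _ < (C + 1) * (ε / (C + 1)) := by gcongr
    _ = ε := by field_simp

lemma continuousOn_integral_tail {g : ℝ → ℝ} {t : ℝ} (hg : IntervalIntegrable g volume 0 t) :
    ContinuousOn (fun τ => ∫ x in τ..t, g x) (uIcc 0 t) := by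
  have h := (hg.absolutelyContinuousOnInterval_intervalIntegral (c := t) (by simp)).continuousOn
  exact h.neg.congr fun τ _ => intervalIntegral.integral_symm _ _

/-- The substitution `u = ∫ x in τ..t, g x` for a merely integrable `g`. -/
lemma integral_mul_comp_integral_tail {Q g : ℝ → ℝ} (hQ : Continuous Q) {t : ℝ}
    (hg : IntervalIntegrable g volume 0 t) :
    ∫ τ in (0 : ℝ)..t, g τ * Q (∫ x in τ..t, g x) =
      ∫ u in (0 : ℝ)..∫ x in (0 : ℝ)..t, g x, Q u := by
  set R : ℝ → ℝ := fun x => ∫ u in (0 : ℝ)..x, Q u with hRdef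
  have hR : ∀ x, HasDerivAt R (Q x) x := fun x =>
    intervalIntegral.integral_hasDerivAt_right (hQ.intervalIntegrable _ _)
      hQ.stronglyMeasurable.stronglyMeasurableAtFilter hQ.continuousAt
  have hR1 : ContDiff ℝ 1 R := by
    rw [contDiff_one_iff_deriv]
    refine ⟨fun x => (hR x).differentiableAt, ?_⟩
    rwa [show deriv R = Q from funext fun x => (hR x).deriv]
  have hac := hg.absolutelyContinuousOnInterval_intervalIntegral (c := t) (by simp)
  obtain ⟨C, hC⟩ := hac.exists_bound
  obtain ⟨L, hL⟩ := (hR1.contDiffOn (s := Icc (-C) C)).exists_lipschitzOnWith (by decide)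
    (convex_Icc _ _) isCompact_Icc
  have hac2 : AbsolutelyContinuousOnInterval (fun τ => R (-∫ x in t..τ, g x)) 0 t := by
    refine hL.comp_absolutelyContinuousOnInterval (f := fun τ => -∫ x in t..τ, g x) hac.neg ?_
    intro x hx
    have := abs_le.1 (hC x hx)
    constructor <;> linarith [this.1, this.2]
  have key := hac2.integral_deriv_eq_sub
  have hder : ∫ τ in (0 : ℝ)..t, deriv (fun τ => R (-∫ x in t..τ, g x)) τ
      = ∫ τ in (0 : ℝ)..t, -(g τ * Q (∫ x in τ..t, g x)) := by
    apply intervalIntegral.integral_congr_ae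
    filter_upwards [hg.ae_hasDerivAt_integral] with x hx hx'
    have h1 := hx (uIoc_subset_uIcc hx') t (by simp)
    have h2 := ((hR (-∫ x in t..x, g x)).comp x h1.neg).deriv
    rw [show (fun τ => R (-∫ x in t..τ, g x)) = R ∘ (fun τ => -∫ x in t..τ, g x) from rfl]
    refine h2.trans ?_
    rw [← intervalIntegral.integral_symm]
    ring
  rw [hder, intervalIntegral.integral_neg] at key
  have hR0 : R 0 = 0 := by simp [hRdef]
  rw [intervalIntegral.integral_same, neg_zero, hR0,
    ← intervalIntegral.integral_symm t 0 (f := g)] at key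
  linarith

/-- The expected number of stories visible at time `t` when they are posted with intensity `M`
and a story is still visible with probability `Q a` once `a` later stories are expected in a feed
with intensity `lam`. -/
def visibleMean (Q M lam : ℝ → ℝ) (t : ℝ) : ℝ :=
  ∫ τ in (0 : ℝ)..t, M τ * Q (∫ x in τ..t, lam x)

lemma intervalIntegrable_mul_comp_tail {Q M lam : ℝ → ℝ} (hQ : Continuous Q) {t : ℝ}
    (hM : IntervalIntegrable M volume 0 t) (hlam : IntervalIntegrable lam volume 0 t) :
    IntervalIntegrable (fun τ => M τ * Q (∫ x in τ..t, lam x)) volume 0 t :=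
  hM.mul_continuousOn (hQ.comp_continuousOn (continuousOn_integral_tail hlam))

lemma visibleMean_self {Q g : ℝ → ℝ} (hQ : Continuous Q) {t : ℝ}
    (hg : IntervalIntegrable g volume 0 t) :
    visibleMean Q g g t = ∫ u in (0 : ℝ)..∫ x in (0 : ℝ)..t, g x, Q u :=
  integral_mul_comp_integral_tail hQ hg

lemma visibleMean_add {Q M N lam : ℝ → ℝ} (hQ : Continuous Q) {t : ℝ}
    (hM : IntervalIntegrable M volume 0 t) (hN : IntervalIntegrable N volume 0 t)
    (hlam : IntervalIntegrable lam volume 0 t) :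
    visibleMean Q (fun x => M x + N x) lam t = visibleMean Q M lam t + visibleMean Q N lam t := by
  unfold visibleMean
  rw [← intervalIntegral.integral_add (intervalIntegrable_mul_comp_tail hQ hM hlam)
    (intervalIntegrable_mul_comp_tail hQ hN hlam)]
  simp only [add_mul]

lemma integral_tail_mono {f g : ℝ → ℝ} {t τ : ℝ} (hτ : τ ∈ Icc 0 t)
    (hf : IntervalIntegrable f volume 0 t) (hg : IntervalIntegrable g volume 0 t)
    (h : ∀ x ∈ Icc 0 t, f x ≤ g x) : ∫ x in τ..t, f x ≤ ∫ x in τ..t, g x := by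
  have hsub : uIcc τ t ⊆ uIcc 0 t := by
    rw [uIcc_of_le hτ.2, uIcc_of_le (hτ.1.trans hτ.2)]; exact Icc_subset_Icc_left hτ.1
  exact intervalIntegral.integral_mono_on hτ.2 (hf.mono_set hsub) (hg.mono_set hsub)
    fun x hx => h x ⟨hτ.1.trans hx.1, hx.2⟩

lemma integral_tail_nonneg {f : ℝ → ℝ} {t τ : ℝ} (hτ : τ ∈ Icc 0 t)
    (h : ∀ x ∈ Icc 0 t, 0 ≤ f x) : 0 ≤ ∫ x in τ..t, f x :=
  intervalIntegral.integral_nonneg hτ.2 fun x hx => h x ⟨hτ.1.trans hx.1, hx.2⟩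

lemma visibleMean_anti {Q M f g : ℝ → ℝ} (hQ : Continuous Q) (hQa : AntitoneOn Q (Ici 0)) {t : ℝ}
    (ht : 0 ≤ t) (hM : IntervalIntegrable M volume 0 t) (hM0 : ∀ x ∈ Icc 0 t, 0 ≤ M x)
    (hf : IntervalIntegrable f volume 0 t) (hg : IntervalIntegrable g volume 0 t)
    (hf0 : ∀ x ∈ Icc 0 t, 0 ≤ f x) (h : ∀ x ∈ Icc 0 t, f x ≤ g x) :
    visibleMean Q M g t ≤ visibleMean Q M f t := by
  refine intervalIntegral.integral_mono_on ht (intervalIntegrable_mul_comp_tail hQ hM hg)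
    (intervalIntegrable_mul_comp_tail hQ hM hf) fun τ hτ => ?_
  exact mul_le_mul_of_nonneg_left (hQa (integral_tail_nonneg hτ hf0)
    ((integral_tail_nonneg hτ hf0).trans (integral_tail_mono hτ hf hg h))
    (integral_tail_mono hτ hf hg h)) (hM0 τ hτ)

/-- What the visibility of intensity `M` in a feed of intensity `lam` loses when the feed gets the
further intensity `m`; as `Q` decreases, this is monotone in `M`. -/
lemma visibleMean_sub_mono {Q M N lam m : ℝ → ℝ} (hQ : Continuous Q) (hQa : AntitoneOn Q (Ici 0))
    {t : ℝ} (ht : 0 ≤ t) (hM : IntervalIntegrable M volume 0 t)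
    (hN : IntervalIntegrable N volume 0 t) (hlam : IntervalIntegrable lam volume 0 t)
    (hm : IntervalIntegrable m volume 0 t) (hlam0 : ∀ x ∈ Icc 0 t, 0 ≤ lam x)
    (hm0 : ∀ x ∈ Icc 0 t, 0 ≤ m x) (h : ∀ x ∈ Ioo 0 t, M x ≤ N x) :
    visibleMean Q M lam t - visibleMean Q M (fun x => lam x + m x) t ≤
      visibleMean Q N lam t - visibleMean Q N (fun x => lam x + m x) t := by
  unfold visibleMean
  have i1 := intervalIntegrable_mul_comp_tail hQ hM hlam
  have i2 := intervalIntegrable_mul_comp_tail hQ hM (hlam.add hm)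
  have i3 := intervalIntegrable_mul_comp_tail hQ hN hlam
  have i4 := intervalIntegrable_mul_comp_tail hQ hN (hlam.add hm)
  rw [← intervalIntegral.integral_sub i1 i2, ← intervalIntegral.integral_sub i3 i4]
  refine intervalIntegral.integral_mono_on_of_le_Ioo ht (i1.sub i2) (i3.sub i4) fun τ hτ => ?_
  have hτ' : τ ∈ Icc 0 t := Ioo_subset_Icc_self hτ
  have hle := integral_tail_mono hτ' hlam (hlam.add hm)
    (fun x hx => le_add_of_nonneg_right (hm0 x hx))
  have hn := integral_tail_nonneg hτ' hlam0
  have hq := hQa hn (hn.trans hle) hle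
  have := mul_le_mul_of_nonneg_right (h τ hτ) (sub_nonneg.2 hq)
  rw [mul_sub, mul_sub] at this
  exact this

lemma visibleMean_const_mul (Q M lam : ℝ → ℝ) (c t : ℝ) :
    visibleMean Q (fun x => c * M x) lam t = c * visibleMean Q M lam t := by
  simp only [visibleMean, mul_assoc, intervalIntegral.integral_const_mul]

/-- The part of the gain that comes from the past before time `0`, if the feed is thought of as
continued there: by `visibleMean_self` it is the integral of `Q` from `∫ lam` to `∫ (lam + m)`. -/
lemma visibleMean_self_sub_anti {Q f g m : ℝ → ℝ} (hQ : Continuous Q) (hQa : AntitoneOn Q (Ici 0))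
    {t : ℝ} (ht : 0 ≤ t) (hf : IntervalIntegrable f volume 0 t)
    (hg : IntervalIntegrable g volume 0 t) (hm : IntervalIntegrable m volume 0 t)
    (hf0 : ∀ x ∈ Icc 0 t, 0 ≤ f x) (hm0 : ∀ x ∈ Icc 0 t, 0 ≤ m x)
    (h : ∀ x ∈ Icc 0 t, f x ≤ g x) :
    visibleMean Q (fun x => g x + m x) (fun x => g x + m x) t - visibleMean Q g g t ≤
      visibleMean Q (fun x => f x + m x) (fun x => f x + m x) t - visibleMean Q f f t := by
  have h0 : (0 : ℝ) ∈ Icc 0 t := ⟨le_rfl, ht⟩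
  have hint : ∀ a b : ℝ, IntervalIntegrable Q volume a b := fun a b => hQ.intervalIntegrable a b
  have hshift : ∀ a b : ℝ, (∫ u in (0 : ℝ)..(a + b), Q u) - ∫ u in (0 : ℝ)..a, Q u
      = ∫ s in (0 : ℝ)..b, Q (a + s) := fun a b => by
    rw [intervalIntegral.integral_interval_sub_left (hint _ _) (hint _ _),
      intervalIntegral.integral_comp_add_left (fun u => Q u), add_zero]
  rw [visibleMean_self hQ hf, visibleMean_self hQ hg, visibleMean_self hQ (hf.add hm),
    visibleMean_self hQ (hg.add hm), intervalIntegral.integral_add hf hm,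
    intervalIntegral.integral_add hg hm, hshift, hshift]
  have hfn := integral_tail_nonneg h0 hf0
  have hle := integral_tail_mono h0 hf hg h
  refine intervalIntegral.integral_mono_on (integral_tail_nonneg h0 hm0)
    ((hQ.comp (continuous_const.add continuous_id)).intervalIntegrable _ _)
    ((hQ.comp (continuous_const.add continuous_id)).intervalIntegrable _ _) fun s hs => ?_
  exact hQa (add_nonneg hfn hs.1) (add_nonneg (hfn.trans hle) hs.1) (by linarith)

lemma visibleMean_self_mono {Q f m : ℝ → ℝ} (hQ : Continuous Q) (hQ0 : ∀ x, 0 ≤ x → 0 ≤ Q x)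
    {t : ℝ} (ht : 0 ≤ t) (hf : IntervalIntegrable f volume 0 t)
    (hm : IntervalIntegrable m volume 0 t)
    (hf0 : ∀ x ∈ Icc 0 t, 0 ≤ f x) (hm0 : ∀ x ∈ Icc 0 t, 0 ≤ m x) :
    visibleMean Q f f t ≤ visibleMean Q (fun x => f x + m x) (fun x => f x + m x) t := by
  have h0 : (0 : ℝ) ∈ Icc 0 t := ⟨le_rfl, ht⟩
  have hfn := integral_tail_nonneg h0 hf0
  have hmn := integral_tail_nonneg h0 hm0
  rw [visibleMean_self hQ hf, visibleMean_self hQ (hf.add hm), intervalIntegral.integral_add hf hm,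
    ← intervalIntegral.integral_add_adjacent_intervals (c := (∫ x in 0..t, f x) + ∫ x in 0..t, m x)
      (hQ.intervalIntegrable 0 (∫ x in 0..t, f x)) (hQ.intervalIntegrable _ _)]
  refine le_add_of_nonneg_right (intervalIntegral.integral_nonneg (by linarith) fun u hu => ?_)
  exact hQ0 u (hfn.trans hu.1)

/-- The growth of the visibility of intensity `M` in a feed of intensity `gam + M` when both get
the further intensity `m`. -/
def visibleGain (Q gam M m : ℝ → ℝ) (t : ℝ) : ℝ :=
  visibleMean Q (fun x => M x + m x) (fun x => gam x + M x + m x) t -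
    visibleMean Q M (fun x => gam x + M x) t

/-- The gain is the growth of the whole feed's visibility plus the loss of the received stories'
visibility. -/
lemma visibleGain_eq {Q gam M m : ℝ → ℝ} (hQ : Continuous Q) {t : ℝ}
    (hgam : IntervalIntegrable gam volume 0 t) (hM : IntervalIntegrable M volume 0 t)
    (hm : IntervalIntegrable m volume 0 t) :
    visibleGain Q gam M m t =
      (visibleMean Q (fun x => gam x + M x + m x) (fun x => gam x + M x + m x) t -
        visibleMean Q (fun x => gam x + M x) (fun x => gam x + M x) t) +
      (visibleMean Q gam (fun x => gam x + M x) t -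
        visibleMean Q gam (fun x => gam x + M x + m x) t) := by
  have e1 := visibleMean_add hQ hgam (hM.add hm) ((hgam.add hM).add hm)
  have e2 := visibleMean_add hQ hgam hM (hgam.add hM)
  have e3 : (fun x => gam x + (M x + m x)) = fun x => gam x + M x + m x := by
    funext x; ring
  rw [e3] at e1
  rw [visibleGain, e1, e2]
  ring

lemma visibleGain_nonneg {Q gam M m : ℝ → ℝ} (hQ : Continuous Q) (hQa : AntitoneOn Q (Ici 0))
    (hQ0 : ∀ x, 0 ≤ x → 0 ≤ Q x) {t : ℝ} (ht : 0 ≤ t)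
    (hgam : IntervalIntegrable gam volume 0 t) (hM : IntervalIntegrable M volume 0 t)
    (hm : IntervalIntegrable m volume 0 t) (hgam0 : ∀ x ∈ Icc 0 t, 0 ≤ gam x)
    (hM0 : ∀ x ∈ Icc 0 t, 0 ≤ M x) (hm0 : ∀ x ∈ Icc 0 t, 0 ≤ m x) :
    0 ≤ visibleGain Q gam M m t := by
  have h0 : ∀ x ∈ Icc 0 t, 0 ≤ gam x + M x := fun x hx => add_nonneg (hgam0 x hx) (hM0 x hx)
  rw [visibleGain_eq hQ hgam hM hm]
  have h1 := visibleMean_self_mono hQ hQ0 ht (hgam.add hM) hm h0 hm0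
  have h2 := visibleMean_anti hQ hQa ht hgam hgam0 (hgam.add hM) ((hgam.add hM).add hm) h0
    fun x hx => le_add_of_nonneg_right (hm0 x hx)
  linarith

/-- The gains in a thin feed `gam + M` and in a thick feed `gam + N` compare up to the factor `c`
if the share of received stories in the thick feed is at most `c` times that in the thin one. -/
lemma visibleGain_le_mul {Q gam M N m : ℝ → ℝ} (hQ : Continuous Q) (hQa : AntitoneOn Q (Ici 0))
    (hQ0 : ∀ x, 0 ≤ x → 0 ≤ Q x) {t : ℝ} (ht : 0 ≤ t)
    (hgam : IntervalIntegrable gam volume 0 t) (hM : IntervalIntegrable M volume 0 t)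
    (hN : IntervalIntegrable N volume 0 t)
    (hm : IntervalIntegrable m volume 0 t) (hgam0 : ∀ x ∈ Icc 0 t, 0 ≤ gam x)
    (hM0 : ∀ x ∈ Icc 0 t, 0 ≤ M x) (hMN : ∀ x ∈ Icc 0 t, M x ≤ N x)
    (hm0 : ∀ x ∈ Icc 0 t, 0 ≤ m x) {k c : ℝ} (hk0 : 0 ≤ k) (hk1 : k ≤ 1) (hc : 1 ≤ c)
    (hlow : ∀ x ∈ Ioo 0 t, k * (gam x + M x) ≤ gam x)
    (hupp : ∀ x ∈ Ioo 0 t, gam x ≤ c * k * (gam x + N x)) :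
    visibleGain Q gam N m t ≤ c * visibleGain Q gam M m t := by
  have h0 : ∀ x ∈ Icc 0 t, 0 ≤ gam x + M x := fun x hx => add_nonneg (hgam0 x hx) (hM0 x hx)
  have h0' : ∀ x ∈ Icc 0 t, 0 ≤ gam x + N x := fun x hx => (h0 x hx).trans
    (by linarith [hMN x hx])
  have hle : ∀ x ∈ Icc 0 t, gam x + M x ≤ gam x + N x := fun x hx => by linarith [hMN x hx]
  have iM := hgam.add hM
  have iN := hgam.add hN
  -- the losses of the received stories, against those of the whole feed
  have d1 := visibleMean_sub_mono hQ hQa ht (iM.const_mul k) hgam iM hm h0 hm0 hlow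
  have d2 := visibleMean_sub_mono hQ hQa ht hgam (iN.const_mul (c * k)) iN hm h0' hm0 hupp
  rw [visibleMean_const_mul, visibleMean_const_mul] at d1 d2
  -- the growth of the whole feed's visibility
  have t1 := visibleMean_self_sub_anti hQ hQa ht iM iN hm h0 hm0 hle
  have t2 := visibleMean_self_mono hQ hQ0 ht iN hm h0' hm0
  -- growth plus loss of the whole feed is the visibility of the new stories
  have s1 := visibleMean_add hQ iM hm (iM.add hm)
  have s2 := visibleMean_add hQ iN hm (iN.add hm)
  have s3 := visibleMean_anti hQ hQa ht hm hm0 (iM.add hm) (iN.add hm)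
    (fun x hx => add_nonneg (h0 x hx) (hm0 x hx))
    (fun x hx => by linarith [hle x hx])
  rw [visibleGain_eq hQ hgam hN hm, visibleGain_eq hQ hgam hM hm]
  generalize visibleMean Q (fun x => gam x + M x + m x) (fun x => gam x + M x + m x) t = a1 at *
  generalize visibleMean Q (fun x => gam x + N x + m x) (fun x => gam x + N x + m x) t = b1 at *
  generalize visibleMean Q (fun x => gam x + M x) (fun x => gam x + M x) t = a2 at *
  generalize visibleMean Q (fun x => gam x + N x) (fun x => gam x + N x) t = b2 at *
  generalize visibleMean Q gam (fun x => gam x + M x) t = a3 at *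
  generalize visibleMean Q gam (fun x => gam x + N x) t = b3 at *
  generalize visibleMean Q gam (fun x => gam x + M x + m x) t = a4 at *
  generalize visibleMean Q gam (fun x => gam x + N x + m x) t = b4 at *
  generalize visibleMean Q m (fun x => gam x + M x + m x) t = a5 at *
  generalize visibleMean Q m (fun x => gam x + N x + m x) t = b5 at *
  generalize visibleMean Q (fun x => gam x + M x) (fun x => gam x + M x + m x) t = a6 at *
  generalize visibleMean Q (fun x => gam x + N x) (fun x => gam x + N x + m x) t = b6 at *
  have u1 : (1 - k) * (b1 - b2) + k * b5 ≤ (1 - k) * (a1 - a2) + k * a5 :=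
    add_le_add (mul_le_mul_of_nonneg_left t1 (by linarith)) (mul_le_mul_of_nonneg_left s3 hk0)
  have u2 : b1 - b2 + k * (b2 - b6) ≤ a1 - a2 + (a3 - a4) := by
    rw [s1, s2] at *
    linarith
  have u3 : c * (b1 - b2 + k * (b2 - b6)) ≤ c * (a1 - a2 + (a3 - a4)) :=
    mul_le_mul_of_nonneg_left u2 (by linarith)
  have u4 : b1 - b2 ≤ c * (b1 - b2) := le_mul_of_one_le_left (by linarith) hc
  linarith

/-! ### The Poisson distribution -/

/-- The probability that a Poisson variable with mean `x` is less than `K`. -/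
def poissonBelow (K : ℕ) (x : ℝ) : ℝ :=
  ∑ k ∈ Finset.range K, Real.exp (-x) * x ^ k / k.factorial

lemma continuous_poissonBelow (K : ℕ) : Continuous (poissonBelow K) := by
  unfold poissonBelow
  fun_prop

lemma poissonBelow_nonneg (K : ℕ) {x : ℝ} (hx : 0 ≤ x) : 0 ≤ poissonBelow K x :=
  Finset.sum_nonneg fun k _ => by positivity

lemma poissonBelow_le_one (K : ℕ) {x : ℝ} (hx : 0 ≤ x) : poissonBelow K x ≤ 1 := by
  lift x to ℝ≥0 using hx
  exact sum_le_hasSum _ (fun k _ => by positivity) (hasSum_one_poissonMeasure x)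

/-- The derivatives of the summands telescope. -/
lemma hasDerivAt_poissonBelow (n : ℕ) (x : ℝ) :
    HasDerivAt (poissonBelow (n + 1)) (-(Real.exp (-x) * x ^ n / n.factorial)) x := by
  have hexp : HasDerivAt (fun x : ℝ => Real.exp (-x)) (-Real.exp (-x)) x := by
    simpa using (hasDerivAt_neg x).exp
  induction n with
  | zero =>
    have : poissonBelow (0 + 1) = fun x : ℝ => Real.exp (-x) := by
      funext y; simp [poissonBelow]
    rw [this]
    simpa using hexp
  | succ n ih =>
    have : poissonBelow (n + 1 + 1) = fun y : ℝ => poissonBelow (n + 1) y +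
        Real.exp (-y) * y ^ (n + 1) / (n + 1).factorial := by
      funext y; rw [poissonBelow, Finset.sum_range_succ]; rfl
    rw [this]
    refine (ih.add ((hexp.mul (hasDerivAt_pow (n + 1) x)).div_const
      ((n + 1).factorial : ℝ))).congr_deriv ?_
    have hn : (n.factorial : ℝ) ≠ 0 := by positivity
    simp only [Nat.factorial_succ, Nat.cast_mul, Nat.cast_add, Nat.cast_one, Nat.add_sub_cancel]
    field_simp
    ring

lemma antitoneOn_poissonBelow (K : ℕ) : AntitoneOn (poissonBelow K) (Ici 0) := by
  cases K with
  | zero => intro x _ y _ _; simp [poissonBelow]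
  | succ n =>
    refine antitoneOn_of_deriv_nonpos (convex_Ici 0) (continuous_poissonBelow _).continuousOn
      (fun x _ => (hasDerivAt_poissonBelow n x).differentiableAt.differentiableWithinAt) ?_
    intro x hx
    rw [interior_Ici, mem_Ioi] at hx
    rw [(hasDerivAt_poissonBelow n x).deriv, neg_nonpos]
    positivity

instance (r : ℝ≥0) : IsProbabilityMeasure ((poissonMeasure r).map ((↑) : ℕ → ℕ∞)) :=
  Measure.isProbabilityMeasure_map (by fun_prop)

lemma map_poissonMeasure_singleton (r : ℝ≥0) (n : ℕ) :
    (poissonMeasure r).map ((↑) : ℕ → ℕ∞) {(n : ℕ∞)} = poissonMeasure r {n} := by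
  rw [Measure.map_apply (by fun_prop) (measurableSet_singleton _)]
  congr 1
  ext k
  simp

/-- Probability measures on `ℕ∞` are determined by their values at natural numbers. -/
lemma ENat.probabilityMeasure_ext {μ ν : Measure ℕ∞} [IsProbabilityMeasure μ]
    [IsProbabilityMeasure ν] (h : ∀ n : ℕ, μ {(n : ℕ∞)} = ν {(n : ℕ∞)}) : μ = ν := by
  have hfin : ∀ ρ : Measure ℕ∞, ρ (range ((↑) : ℕ → ℕ∞)) = ∑' n : ℕ, ρ {(n : ℕ∞)} := fun ρ => by
    rw [← iUnion_singleton_eq_range, measure_iUnion _ fun _ => measurableSet_singleton _]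
    intro a b hab
    simpa using hab
  have htop : ({⊤} : Set ℕ∞) = (range ((↑) : ℕ → ℕ∞))ᶜ := by
    ext x
    cases x <;> simp
  refine Measure.ext_of_singleton fun x => ?_
  cases x with
  | coe n => exact h n
  | top =>
    rw [htop, prob_compl_eq_one_sub (by measurability), prob_compl_eq_one_sub (by measurability),
      hfin, hfin]
    simp_rw [h]

/-- A random variable with values in `ℕ∞` is Poisson distributed, with mean `r`. -/
abbrev HasPoissonLaw {Ω : Type*} [MeasurableSpace Ω] (P : Measure Ω) (X : Ω → ℕ∞) (r : ℝ≥0) :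
    Prop :=
  HasLaw X ((poissonMeasure r).map ((↑) : ℕ → ℕ∞)) P

section HasPoissonLaw

variable {Ω : Type*} [MeasurableSpace Ω] {P : Measure Ω} {X : Ω → ℕ∞} {r : ℝ≥0}

lemma hasPoissonLaw_of_forall [IsProbabilityMeasure P] (hX : Measurable X)
    (h : ∀ n : ℕ, P {ω | X ω = (n : ℕ∞)} = poissonMeasure r {n}) : HasPoissonLaw P X r := by
  refine ⟨hX.aemeasurable, ?_⟩
  have := Measure.isProbabilityMeasure_map (μ := P) hX.aemeasurable
  refine ENat.probabilityMeasure_ext fun n => ?_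
  rw [map_poissonMeasure_singleton, ← h n, Measure.map_apply hX (measurableSet_singleton _)]
  rfl

lemma HasPoissonLaw.lintegral (h : HasPoissonLaw P X r) : ∫⁻ ω, (X ω : ℝ≥0∞) ∂P = r := by
  have h1 : ∫⁻ ω, (X ω : ℝ≥0∞) ∂P = ∫⁻ x : ℕ∞, (x : ℝ≥0∞) ∂(P.map X) :=
    (lintegral_map' (by fun_prop) h.aemeasurable).symm
  rw [h1, h.map_eq, lintegral_map (by fun_prop) (by fun_prop), lintegral_countable']
  have hs : HasSum (fun n : ℕ => ((n : ℝ) * (Real.exp (-r) * r ^ n / n.factorial))) r := by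
    rw [← hasSum_nat_add_iff' 1]
    have := (hasSum_one_poissonMeasure r).mul_left (r : ℝ)
    simp only [mul_one] at this
    rw [Finset.sum_range_one, Nat.cast_zero, zero_mul, sub_zero]
    refine this.congr_fun fun n => ?_
    have hn : (n.factorial : ℝ) ≠ 0 := by positivity
    simp only [Nat.factorial_succ, Nat.cast_mul, Nat.cast_add, Nat.cast_one]
    have : (n : ℝ) + 1 ≠ 0 := by positivity
    field_simp
    ring
  have h2 : ∀ n : ℕ, (((n : ℕ∞) : ℝ≥0∞)) * poissonMeasure r {n}
      = ENNReal.ofReal ((n : ℝ) * (Real.exp (-r) * r ^ n / n.factorial)) := fun n => by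
    rw [poissonMeasure_singleton, ENNReal.ofReal_mul (by positivity), ENNReal.ofReal_natCast,
      ENat.toENNReal_coe]
  simp_rw [h2]
  rw [← ENNReal.ofReal_tsum_of_nonneg (fun n => by positivity) hs.summable, hs.tsum_eq,
    ENNReal.ofReal_coe_nnreal]

lemma HasPoissonLaw.ae_lt_top (h : HasPoissonLaw P X r) : ∀ᵐ ω ∂P, X ω < ⊤ := by
  have := ae_lt_top' (f := fun ω => (X ω : ℝ≥0∞)) (μ := P)
    (((by fun_prop : Measurable (fun x : ℕ∞ => (x : ℝ≥0∞))).comp_aemeasurable h.aemeasurable))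
    (by rw [h.lintegral]; exact ENNReal.coe_ne_top)
  filter_upwards [this] with ω hω
  exact ENat.toENNReal_lt_top.1 hω

lemma HasPoissonLaw.measure_lt (h : HasPoissonLaw P X r) (K : ℕ) :
    P {ω | X ω < (K : ℕ∞)} = ENNReal.ofReal (poissonBelow K r) := by
  have hset : {x : ℕ∞ | x < (K : ℕ∞)} = ⋃ n ∈ Finset.range K, {(n : ℕ∞)} := by
    ext x
    cases x <;> simp
  have h1 : P {ω | X ω < (K : ℕ∞)} = P.map X {x : ℕ∞ | x < (K : ℕ∞)} :=
    (Measure.map_apply_of_aemeasurable h.aemeasurable (MeasurableSet.of_discrete)).symm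
  rw [h1, h.map_eq, hset, measure_biUnion_finset _ fun _ _ => measurableSet_singleton _]
  · rw [poissonBelow, ENNReal.ofReal_sum_of_nonneg fun k _ => by positivity]
    exact Finset.sum_congr rfl fun n _ => by
      rw [map_poissonMeasure_singleton, poissonMeasure_singleton]
  · intro a _ b _ hab
    simpa using hab

end HasPoissonLaw

/-! ### Independence and Poisson laws of the arrival counts -/

lemma ProbabilityTheory.Indep.indepFun {Ω β γ : Type*} {m₁ m₂ m₀ : MeasurableSpace Ω}
    {P : Measure[m₀] Ω} {mβ : MeasurableSpace β} {mγ : MeasurableSpace γ} {X : Ω → β} {Y : Ω → γ}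
    (h : Indep m₁ m₂ P) (hX : Measurable[m₁] X) (hY : Measurable[m₂] Y) : IndepFun X Y P :=
  (IndepFun_iff_Indep X Y P).2 (indep_of_indep_of_le h hX.comap_le hY.comap_le)

lemma ProbabilityTheory.IndepFun.prodMk_right {Ω α β γ : Type*} {mΩ : MeasurableSpace Ω}
    {P : Measure Ω} [IsProbabilityMeasure P] {mα : MeasurableSpace α} {mβ : MeasurableSpace β}
    {mγ : MeasurableSpace γ} {X : Ω → α} {Y : Ω → β} {Z : Ω → γ} (hX : Measurable X)
    (hY : Measurable Y) (hZ : Measurable Z) (hXY : IndepFun X Y P)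
    (hXYZ : IndepFun (fun ω => (X ω, Y ω)) Z P) : IndepFun X (fun ω => (Y ω, Z ω)) P := by
  have hYZ : IndepFun Y Z P := hXYZ.comp (φ := Prod.snd) (ψ := id) measurable_snd measurable_id
  have := Measure.isProbabilityMeasure_map (μ := P) hX.aemeasurable
  have := Measure.isProbabilityMeasure_map (μ := P) hY.aemeasurable
  have := Measure.isProbabilityMeasure_map (μ := P) hZ.aemeasurable
  rw [indepFun_iff_map_prod_eq_prod_map_map hX.aemeasurable (hY.prodMk hZ).aemeasurable,
    hYZ.map_prod_eq_prod_map_map hY.aemeasurable hZ.aemeasurable, ← Measure.prodAssoc_prod,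
    ← hXY.map_prod_eq_prod_map_map hX.aemeasurable hY.aemeasurable,
    ← hXYZ.map_prod_eq_prod_map_map (hX.prodMk hY).aemeasurable hZ.aemeasurable,
    Measure.map_map (MeasurableEquiv.measurable _) ((hX.prodMk hY).prodMk hZ)]
  rfl

lemma measurable_pointSigma {Ω : Type*} {T : ℝ} {S : Ω → Set ℝ} {A : Set ℝ}
    (hA : MeasurableSet A) (hAT : A ⊆ Icc 0 T) : Measurable[pointSigma T S] (pointCount S A) :=
  measurable_iff_comap_le.2 (le_iSup (fun A : {A : Set ℝ // MeasurableSet A ∧ A ⊆ Icc 0 T} =>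
    MeasurableSpace.comap (pointCount S A.1) ⊤) ⟨A, hA, hAT⟩)

namespace IsPoissonProcess

variable {Ω : Type*} [MeasurableSpace Ω] {P : Measure Ω} {T : ℝ} {lam : ℝ → ℝ} {S : Ω → Set ℝ}

lemma pointSigma_le (h : IsPoissonProcess P T lam S) : pointSigma T S ≤ ‹MeasurableSpace Ω› :=
  iSup_le fun A => (h.measurable_count A.1 A.2.1 A.2.2).comap_le

lemma hasPoissonLaw [IsProbabilityMeasure P] (h : IsPoissonProcess P T lam S) {A : Set ℝ}
    (hA : MeasurableSet A) (hAT : A ⊆ Icc 0 T) :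
    HasPoissonLaw P (pointCount S A) (∫ x in A, lam x).toNNReal :=
  hasPoissonLaw_of_forall (h.measurable_count A hA hAT) (h.count_law A hA hAT)

lemma indepFun_of_disjoint (h : IsPoissonProcess P T lam S) {A B : Set ℝ}
    (hA : MeasurableSet A) (hAT : A ⊆ Icc 0 T) (hB : MeasurableSet B) (hBT : B ⊆ Icc 0 T)
    (hAB : Disjoint A B) : IndepFun (pointCount S A) (pointCount S B) P := by
  have := h.indep_count 2 ![A, B] (by simp [Fin.forall_fin_two, hA, hB])
    (by simp [Fin.forall_fin_two, hAT, hBT])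
    (by simp [Fin.forall_fin_two, hAB, hAB.symm])
  exact this.indepFun (i := 0) (j := 1) (by decide)

end IsPoissonProcess

namespace FeedModel

variable {V : Type*} [Fintype V] [DecidableEq V] {Ω : Type*} [MeasurableSpace Ω]
  {P : Measure Ω} {T : ℝ}

/-- The σ-algebra generated by the posts of the broadcasters in `G`. -/
abbrev postSigma (m : FeedModel V P T) (G : Set V) : MeasurableSpace Ω :=
  ⨆ i ∈ {i : {i // i ∈ m.bc} | i.1 ∈ G}, pointSigma T (m.post i.1)

lemma postSigma_le (m : FeedModel V P T) (G : Set V) : m.postSigma G ≤ ‹MeasurableSpace Ω› :=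
  iSup₂_le fun i _ => (m.post_poisson i.1 i.2).pointSigma_le

lemma postSigma_mono (m : FeedModel V P T) {G H : Set V} (h : G ⊆ H) :
    m.postSigma G ≤ m.postSigma H :=
  biSup_mono fun _ hi => h hi

lemma indep_postSigma (m : FeedModel V P T) {G H : Set V} (h : Disjoint G H) :
    Indep (m.postSigma G) (m.postSigma H) P := by
  have hle : ∀ i : {i // i ∈ m.bc}, pointSigma T (m.post i.1) ≤ ‹MeasurableSpace Ω› :=
    fun i => (m.post_poisson i.1 i.2).pointSigma_le
  have hGH : Disjoint {i : {i // i ∈ m.bc} | i.1 ∈ G} {i : {i // i ∈ m.bc} | i.1 ∈ H} :=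
    Set.disjoint_left.2 fun i hi hi' => Set.disjoint_left.1 h hi hi'
  exact indep_iSup_of_disjoint hle m.indep_post hGH

lemma indep_recv_postSigma (m : FeedModel V P T) {j : V} {G : Set V}
    (hG : ∀ i ∈ G, (i, j) ∈ m.cand) : Indep (m.postSigma G) (pointSigma T (m.recv j)) P :=
  indep_of_indep_of_le_left (m.indep_recv j).symm <| iSup₂_le fun i hi =>
    le_iSup (fun i : {i // (i, j) ∈ m.cand} => pointSigma T (m.post i.1)) ⟨i.1, hG _ hi⟩

variable (m : FeedModel V P T)

lemma measurable_pointCount_post {A : Set ℝ} (hA : MeasurableSet A) (hAT : A ⊆ Icc 0 T)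
    {G : Set V} {i : V} (hi : i ∈ m.bc) (hG : i ∈ G) :
    Measurable[m.postSigma G] (pointCount (m.post i) A) :=
  (measurable_pointSigma hA hAT).mono
    (le_iSup₂ (f := fun (i : {i // i ∈ m.bc}) (_ : i ∈ {i : {i // i ∈ m.bc} | i.1 ∈ G}) =>
      pointSigma T (m.post i.1)) ⟨i, hi⟩ hG) le_rfl

lemma measurable_sum_pointCount_post {A : Set ℝ} (hA : MeasurableSet A) (hAT : A ⊆ Icc 0 T)
    {s : Finset V} (hs : s ⊆ m.bc) {G : Set V} (hG : ∀ i ∈ s, i ∈ G) :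
    Measurable[m.postSigma G] (fun ω => ∑ i ∈ s, pointCount (m.post i) A ω) :=
  @Finset.measurable_sum _ _ _ _ _ _ (m.postSigma G) _ s fun i hi =>
    m.measurable_pointCount_post hA hAT (hs hi) (hG i hi)

/-- The arrivals in `A` from the received stories and from the broadcasters in `s`. -/
def arrivals (j : V) (s : Finset V) (A : Set ℝ) (ω : Ω) : ℕ∞ :=
  pointCount (m.recv j) A ω + ∑ i ∈ s, pointCount (m.post i) A ω

/-- The intensity of the arrivals from the received stories and from the broadcasters in `s`. -/
def arrivalIntensity (j : V) (s : Finset V) (t : ℝ) : ℝ := m.gamma j t + ∑ i ∈ s, m.mu i t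

lemma measurable_arrivals {j : V} {s : Finset V} {A : Set ℝ} (hA : MeasurableSet A)
    (hAT : A ⊆ Icc 0 T) (hs : s ⊆ m.bc) : Measurable (m.arrivals j s A) :=
  ((m.recv_poisson j).measurable_count A hA hAT).add
    (Finset.measurable_sum _ fun i hi => (m.post_poisson i (hs hi)).measurable_count A hA hAT)

lemma arrivals_insert {j i : V} {s : Finset V} (hi : i ∉ s) (A : Set ℝ) (ω : Ω) :
    m.arrivals j (insert i s) A ω = pointCount (m.post i) A ω + m.arrivals j s A ω := by
  simp only [arrivals, Finset.sum_insert hi]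
  ring

/-- What depends only on the posts of `i` is independent of the arrivals from elsewhere. -/
lemma indepFun_arrivals [IsProbabilityMeasure P] {β : Type*} [MeasurableSpace β] {X : Ω → β}
    {i j : V} {s : Finset V} {A : Set ℝ} (hA : MeasurableSet A) (hAT : A ⊆ Icc 0 T)
    (hs : ∀ k ∈ insert i s, (k, j) ∈ m.cand) (hi : i ∉ s) (hX : Measurable[m.postSigma {i}] X) :
    IndepFun X (m.arrivals j s A) P := by
  have hbc : s ⊆ m.bc := fun k hk => m.source_mem _ (hs k (Finset.mem_insert_of_mem hk))
  set Y : Ω → ℕ∞ := fun ω => ∑ k ∈ s, pointCount (m.post k) A ω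
  have hY : Measurable[m.postSigma s] Y := m.measurable_sum_pointCount_post hA hAT hbc fun _ h => h
  have hXY : IndepFun X Y P := (m.indep_postSigma (by simpa using hi)).indepFun hX hY
  have hZ : Measurable[pointSigma T (m.recv j)] (pointCount (m.recv j) A) :=
    measurable_pointSigma hA hAT
  have hpair : Measurable[m.postSigma (insert i (s : Set V))] (fun ω => (X ω, Y ω)) :=
    (hX.mono (m.postSigma_mono (by simp)) le_rfl).prodMk
      (hY.mono (m.postSigma_mono (by simp)) le_rfl)
  have hXYZ : IndepFun (fun ω => (X ω, Y ω)) (pointCount (m.recv j) A) P :=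
    (m.indep_recv_postSigma (by simpa using hs)).indepFun hpair hZ
  have := (hXY.prodMk_right (hX.mono (m.postSigma_le _) le_rfl) (hY.mono (m.postSigma_le _) le_rfl)
    (hZ.mono (m.recv_poisson j).pointSigma_le le_rfl) hXYZ).comp (φ := id)
    (ψ := fun p : ℕ∞ × ℕ∞ => p.2 + p.1) measurable_id (by fun_prop)
  exact this

/-- Superposition of independent Poisson processes. -/
lemma hasPoissonLaw_arrivals [IsProbabilityMeasure P] {j : V} {s : Finset V} {A : Set ℝ}
    (hA : MeasurableSet A) (hAT : A ⊆ Icc 0 T) (hs : ∀ k ∈ s, (k, j) ∈ m.cand) :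
    HasPoissonLaw P (m.arrivals j s A) (∫ x in A, m.arrivalIntensity j s x).toNNReal := by
  unfold arrivalIntensity
  induction s using Finset.induction_on with
  | empty =>
    have : m.arrivals j ∅ A = pointCount (m.recv j) A := by
      funext ω; simp [arrivals]
    simpa [this] using (m.recv_poisson j).hasPoissonLaw hA hAT
  | insert i s hi ih =>
    have hbc : ∀ k ∈ insert i s, k ∈ m.bc := fun k hk => m.source_mem _ (hs k hk)
    have hib := hbc i (Finset.mem_insert_self i s)
    have hint : ∀ k ∈ insert i s, IntegrableOn (m.mu k) A := fun k hk =>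
      (m.mu_intensity k (hbc k hk)).integrable.mono_set hAT
    have hint' : ∀ k ∈ s, IntegrableOn (m.mu k) A := fun k hk =>
      hint k (Finset.mem_insert_of_mem hk)
    have hg : IntegrableOn (m.gamma j) A := (m.gamma_intensity j).integrable.mono_set hAT
    have hind : IndepFun (pointCount (m.post i) A) (m.arrivals j s A) P :=
      m.indepFun_arrivals hA hAT hs hi (m.measurable_pointCount_post hA hAT hib (by simp))
    have hlaw := hind.hasLaw_add_map_cast_poissonMeasure
      ((m.post_poisson i hib).hasPoissonLaw hA hAT)
      (ih fun k hk => hs k (Finset.mem_insert_of_mem hk))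
    have hfun : m.arrivals j (insert i s) A = pointCount (m.post i) A + m.arrivals j s A := by
      funext ω; exact m.arrivals_insert hi A ω
    have hmean : (∫ x in A, (m.gamma j x + ∑ k ∈ insert i s, m.mu k x)).toNNReal
        = (∫ x in A, m.mu i x).toNNReal
          + (∫ x in A, (m.gamma j x + ∑ k ∈ s, m.mu k x)).toNNReal := by
      have hg' : IntegrableOn (fun x => m.gamma j x + ∑ k ∈ s, m.mu k x) A :=
        hg.add (integrable_finsetSum _ hint')
      rw [← Real.toNNReal_add, ← integral_add (hint i (Finset.mem_insert_self i s)) hg']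
      · congr 1
        refine integral_congr_ae (ae_of_all _ fun x => ?_)
        simp only [Finset.sum_insert hi]
        ring
      · exact setIntegral_nonneg hA fun x hx => (m.mu_intensity i hib).nonneg x (hAT hx)
      · refine setIntegral_nonneg hA fun x hx => add_nonneg
          ((m.gamma_intensity j).nonneg x (hAT hx)) (Finset.sum_nonneg fun k hk => ?_)
        exact (m.mu_intensity k (hbc k (Finset.mem_insert_of_mem hk))).nonneg x (hAT hx)
    rw [HasPoissonLaw, hfun, hmean]
    exact hlaw

/-- The posts of `i` in `A` are independent of all arrivals in a set disjoint from `A`. -/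
lemma indepFun_pointCount_arrivals [IsProbabilityMeasure P] {i j : V} {s : Finset V} {A B : Set ℝ}
    (hA : MeasurableSet A) (hAT : A ⊆ Icc 0 T) (hB : MeasurableSet B) (hBT : B ⊆ Icc 0 T)
    (hAB : Disjoint A B) (hs : ∀ k ∈ s, (k, j) ∈ m.cand) (hi : i ∈ s) :
    IndepFun (pointCount (m.post i) A) (m.arrivals j s B) P := by
  have hib := m.source_mem _ (hs i hi)
  have hX := m.measurable_pointCount_post (G := {i}) hA hAT hib rfl
  have hY := m.measurable_pointCount_post (G := {i}) hB hBT hib rfl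
  have hXY := (m.post_poisson i hib).indepFun_of_disjoint hA hAT hB hBT hAB
  have hbc : s.erase i ⊆ m.bc := fun k hk => m.source_mem _ (hs k (Finset.mem_of_mem_erase hk))
  have hXYZ := m.indepFun_arrivals (j := j) (s := s.erase i) hB hBT
    (by rwa [Finset.insert_erase hi]) (Finset.notMem_erase i s) (hX.prodMk hY)
  have := (hXY.prodMk_right (hX.mono (m.postSigma_le _) le_rfl)
    (hY.mono (m.postSigma_le _) le_rfl) (m.measurable_arrivals hB hBT hbc) hXYZ).comp
    (φ := id) (ψ := fun p : ℕ∞ × ℕ∞ => p.1 + p.2) measurable_id (by fun_prop)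
  convert! this using 1
  funext ω
  rw [← Finset.insert_erase hi, m.arrivals_insert (Finset.notMem_erase i s),
    Finset.erase_insert (Finset.notMem_erase i s)]
  rfl

end FeedModel

open Filter Topology

/-! ### Discretization of time -/

/-- The right end of the cell of the grid of mesh `1 / (n + 1)` that contains `τ`. -/
def gridRight (n : ℕ) (τ : ℝ) : ℝ := ((⌊((n : ℝ) + 1) * τ⌋₊ : ℝ) + 1) / ((n : ℝ) + 1)

lemma lt_gridRight (n : ℕ) (τ : ℝ) : τ < gridRight n τ := by
  rw [gridRight, lt_div_iff₀ (by positivity), mul_comm]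
  exact Nat.lt_floor_add_one _

lemma tendsto_gridRight {τ : ℝ} (hτ : 0 ≤ τ) :
    Tendsto (fun n => gridRight n τ) atTop (𝓝 τ) := by
  have h : Tendsto (fun n : ℕ => τ + 1 / ((n : ℝ) + 1)) atTop (𝓝 τ) := by
    simpa using tendsto_one_div_add_atTop_nhds_zero_nat.const_add τ
  refine tendsto_of_tendsto_of_tendsto_of_le_of_le tendsto_const_nhds h
    (fun n => (lt_gridRight n τ).le) fun n => ?_
  have hn : (0 : ℝ) < (n : ℝ) + 1 := by positivity
  have := Nat.floor_le (mul_nonneg hn.le hτ)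
  rw [gridRight, div_le_iff₀ hn, add_mul _ _ ((n : ℝ) + 1), one_div, inv_mul_cancel₀ hn.ne']
  linarith [mul_comm τ ((n : ℝ) + 1)]

/-- The `k`-th cell of the grid of mesh `1 / (n + 1)` on `[0, t]`. -/
def gridCell (n : ℕ) (t : ℝ) (k : ℕ) : Set ℝ := Icc 0 t ∩ {τ | ⌊((n : ℝ) + 1) * τ⌋₊ = k}

lemma gridCell_subset (n : ℕ) (t : ℝ) (k : ℕ) : gridCell n t k ⊆ Icc 0 t := inter_subset_left

lemma measurable_floor_mul (n : ℕ) : Measurable fun τ : ℝ => ⌊((n : ℝ) + 1) * τ⌋₊ :=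
  Nat.measurable_floor.comp (measurable_const_mul _)

lemma measurableSet_gridCell (n : ℕ) (t : ℝ) (k : ℕ) : MeasurableSet (gridCell n t k) :=
  measurableSet_Icc.inter (measurable_floor_mul n (measurableSet_singleton k))

lemma gridRight_of_mem {n k : ℕ} {t τ : ℝ} (h : τ ∈ gridCell n t k) :
    gridRight n τ = ((k : ℝ) + 1) / ((n : ℝ) + 1) := by
  rw [gridRight, show ⌊((n : ℝ) + 1) * τ⌋₊ = k from h.2]

lemma disjoint_gridCell_Ioc (n : ℕ) (t : ℝ) (k : ℕ) :
    Disjoint (gridCell n t k) (Ioc (((k : ℝ) + 1) / ((n : ℝ) + 1)) t) :=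
  Set.disjoint_left.2 fun τ h h' => by
    have := lt_gridRight n τ
    rw [gridRight_of_mem h] at this
    exact this.not_gt h'.1

lemma Ioc_grid_subset {n k : ℕ} {t T : ℝ} (ht : t ≤ T) :
    Ioc (((k : ℝ) + 1) / ((n : ℝ) + 1)) t ⊆ Icc 0 T := fun _ hx =>
  ⟨(show (0 : ℝ) ≤ ((k : ℝ) + 1) / ((n : ℝ) + 1) by positivity).trans hx.1.le, hx.2.trans ht⟩

lemma iUnion_gridCell (n : ℕ) (t : ℝ) : ⋃ k, gridCell n t k = Icc 0 t := by
  ext τ; simp [gridCell]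

lemma pairwise_disjoint_gridCell (n : ℕ) (t : ℝ) :
    Pairwise (Function.onFun Disjoint (gridCell n t)) :=
  fun _ _ hab => Set.disjoint_left.2 fun _ ha hb => hab (ha.2.symm.trans hb.2)

/-! ### Counting points -/

section pointCount

variable {Ω : Type*} {S : Ω → Set ℝ} {ω : Ω}

lemma pointCount_mono {A B : Set ℝ} (h : A ⊆ B) : pointCount S A ω ≤ pointCount S B ω :=
  encard_le_encard (inter_subset_inter_right _ h)

lemma pointCount_union {A B : Set ℝ} (h : Disjoint A B) :
    pointCount S (A ∪ B) ω = pointCount S A ω + pointCount S B ω := by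
  rw [pointCount, inter_union_distrib_left, encard_union_eq (h.mono inter_subset_right
    inter_subset_right)]
  rfl

lemma pointCount_eq_zero {A : Set ℝ} : pointCount S A ω = 0 ↔ S ω ∩ A = ∅ := encard_eq_zero

lemma eventually_pointCount_Ioc_eq_zero {T τ : ℝ} (hτ : 0 ≤ τ)
    (h : pointCount S (Icc 0 T) ω < ⊤) :
    ∀ᶠ u in 𝓝 τ, u ≤ T → pointCount S (Ioc τ u) ω = 0 := by
  have hfin : (S ω ∩ Icc 0 T).Finite := encard_lt_top_iff.1 h
  have : ∀ᶠ u in 𝓝 τ, ∀ x ∈ S ω ∩ Icc 0 T, x ∉ Ioc τ u := by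
    rw [eventually_all_finite hfin]
    intro x _
    rcases le_or_gt x τ with hx | hx
    · exact Eventually.of_forall fun u hu => hx.not_gt hu.1
    · filter_upwards [eventually_lt_nhds hx] with u hu hxu using hu.not_ge hxu.2
  filter_upwards [this] with u hu huT
  rw [pointCount_eq_zero, eq_empty_iff_forall_notMem]
  exact fun x hx => hu x ⟨hx.1, hτ.trans hx.2.1.le, hx.2.2.trans huT⟩ hx.2

end pointCount

namespace FeedModel

variable {V : Type*} [Fintype V] [DecidableEq V] {Ω : Type*} [MeasurableSpace Ω]
  {P : Measure Ω} {T : ℝ} (m : FeedModel V P T) {j : V} {s : Finset V} {ω : Ω}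

lemma arrivals_union {A B : Set ℝ} (h : Disjoint A B) :
    m.arrivals j s (A ∪ B) ω = m.arrivals j s A ω + m.arrivals j s B ω := by
  simp only [arrivals, pointCount_union h, Finset.sum_add_distrib]
  ring

lemma arrivals_Ioc_add {a b c : ℝ} (hab : a ≤ b) (hbc : b ≤ c) :
    m.arrivals j s (Ioc a c) ω = m.arrivals j s (Ioc a b) ω + m.arrivals j s (Ioc b c) ω := by
  rw [← Ioc_union_Ioc_eq_Ioc hab hbc, m.arrivals_union (Ioc_disjoint_Ioc_of_le le_rfl)]

lemma pointCount_post_le_arrivals {i : V} (hi : i ∈ s) (A : Set ℝ) :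
    pointCount (m.post i) A ω ≤ m.arrivals j s A ω :=
  (Finset.single_le_sum (f := fun i => pointCount (m.post i) A ω) (fun _ _ => zero_le) hi).trans
    le_add_self

lemma eventually_arrivals_Ioc_eq_zero {τ : ℝ} (hτ : 0 ≤ τ)
    (h : m.arrivals j s (Icc 0 T) ω < ⊤) :
    ∀ᶠ u in 𝓝 τ, u ≤ T → m.arrivals j s (Ioc τ u) ω = 0 := by
  have h1 := eventually_pointCount_Ioc_eq_zero (S := m.recv j) hτ (le_self_add.trans_lt h)
  have h2 : ∀ᶠ u in 𝓝 τ, ∀ i ∈ s, u ≤ T → pointCount (m.post i) (Ioc τ u) ω = 0 :=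
    (eventually_all_finset s).2 fun i hi =>
      eventually_pointCount_Ioc_eq_zero hτ ((m.pointCount_post_le_arrivals hi _).trans_lt h)
  filter_upwards [h1, h2] with u hu hu' huT
  rw [arrivals, hu huT, Finset.sum_eq_zero fun i hi => hu' i hi huT, add_zero]

lemma eventually_arrivals_gridRight {t τ : ℝ} (hτ : τ ∈ Icc 0 t) (ht : t ≤ T)
    (h : m.arrivals j s (Icc 0 T) ω < ⊤) :
    ∀ᶠ n in atTop, m.arrivals j s (Ioc (gridRight n τ) t) ω = m.arrivals j s (Ioc τ t) ω := by
  rcases hτ.2.eq_or_lt with rfl | hlt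
  · refine Eventually.of_forall fun n => ?_
    rw [Ioc_eq_empty (lt_gridRight n τ).not_gt, Ioc_self]
  · have h0 := (tendsto_gridRight hτ.1).eventually (m.eventually_arrivals_Ioc_eq_zero hτ.1 h)
    have h1 := (tendsto_gridRight hτ.1).eventually (eventually_lt_nhds hlt)
    filter_upwards [h0, h1] with n hn hn'
    rw [m.arrivals_Ioc_add (lt_gridRight n τ).le hn'.le, hn (hn'.le.trans ht), zero_add]

/-- The number of posts of `i` among the top `K` positions of a feed, at time `t`. -/
def topPosts (K : ℕ) (i j : V) (s : Finset V) (t : ℝ) (ω : Ω) : ℕ∞ :=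
  {τ : ℝ | τ ∈ m.post i ω ∧ τ ∈ Icc 0 t ∧ m.arrivals j s (Ioc τ t) ω < (K : ℕ∞)}.encard

/-- The discretization of `topPosts` that ignores the arrivals in the grid cell of the post: its
summands are products of independent factors. -/
def gridPosts (K n : ℕ) (i j : V) (s : Finset V) (t : ℝ) (ω : Ω) : ℝ≥0∞ :=
  ∑' k : ℕ, (pointCount (m.post i) (gridCell n t k) ω : ℝ≥0∞) *
    {ω | m.arrivals j s (Ioc (((k : ℝ) + 1) / ((n : ℝ) + 1)) t) ω < (K : ℕ∞)}.indicator 1 ω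

variable {K : ℕ} {i : V}

open Classical in
lemma gridPosts_eq_sum {n : ℕ} {t : ℝ} (D : Finset ℝ)
    (hD : (D : Set ℝ) = m.post i ω ∩ Icc 0 t) :
    m.gridPosts K n i j s t ω =
      ∑ τ ∈ D, if m.arrivals j s (Ioc (gridRight n τ) t) ω < (K : ℕ∞) then 1 else 0 := by
  have hcell : ∀ k, (pointCount (m.post i) (gridCell n t k) ω : ℝ≥0∞)
      = ∑ τ ∈ D, if ⌊((n : ℝ) + 1) * τ⌋₊ = k then 1 else 0 := fun k => by
    have : m.post i ω ∩ gridCell n t k = ↑(D.filter fun τ => ⌊((n : ℝ) + 1) * τ⌋₊ = k) := by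
      rw [Finset.coe_filter, gridCell, ← inter_assoc, ← hD]
      rfl
    rw [pointCount, this, encard_coe_eq_coe_finsetCard, ENat.toENNReal_coe, Finset.sum_boole]
  simp only [gridPosts, hcell, Finset.sum_mul]
  rw [Summable.tsum_finsetSum fun _ _ => ENNReal.summable]
  refine Finset.sum_congr rfl fun τ _ => ?_
  rw [tsum_eq_single ⌊((n : ℝ) + 1) * τ⌋₊ fun k hk => by rw [if_neg hk.symm, zero_mul], if_pos rfl,
    one_mul]
  simp only [indicator_apply, mem_ofPred_eq, gridRight, Pi.one_apply]
  congr

open Classical in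
lemma topPosts_eq_sum {t : ℝ} (D : Finset ℝ) (hD : (D : Set ℝ) = m.post i ω ∩ Icc 0 t) :
    (m.topPosts K i j s t ω : ℝ≥0∞) =
      ∑ τ ∈ D, if m.arrivals j s (Ioc τ t) ω < (K : ℕ∞) then 1 else 0 := by
  have : {τ : ℝ | τ ∈ m.post i ω ∧ τ ∈ Icc 0 t ∧ m.arrivals j s (Ioc τ t) ω < (K : ℕ∞)}
      = ↑(D.filter fun τ => m.arrivals j s (Ioc τ t) ω < (K : ℕ∞)) := by
    rw [Finset.coe_filter]
    ext τ
    have : τ ∈ D ↔ τ ∈ m.post i ω ∩ Icc 0 t := by rw [← hD]; rfl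
    simp only [mem_ofPred_eq, this, mem_inter_iff, and_assoc]
  rw [topPosts, this, encard_coe_eq_coe_finsetCard, ENat.toENNReal_coe, Finset.sum_boole]

lemma exists_finset_posts {t : ℝ} (ht : t ≤ T) (hi : i ∈ s)
    (h : m.arrivals j s (Icc 0 T) ω < ⊤) : ∃ D : Finset ℝ, (D : Set ℝ) = m.post i ω ∩ Icc 0 t :=
  (encard_lt_top_iff.1 (((pointCount_mono (Icc_subset_Icc_right ht)).trans
    (m.pointCount_post_le_arrivals hi _)).trans_lt h)).exists_finset_coe

lemma tendsto_gridPosts {t : ℝ} (ht : t ≤ T) (hi : i ∈ s)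
    (h : m.arrivals j s (Icc 0 T) ω < ⊤) :
    Tendsto (fun n => m.gridPosts K n i j s t ω) atTop (𝓝 (m.topPosts K i j s t ω)) := by
  obtain ⟨D, hD⟩ := m.exists_finset_posts ht hi h
  have hev : ∀ᶠ n in atTop, ∀ τ ∈ D,
      m.arrivals j s (Ioc (gridRight n τ) t) ω = m.arrivals j s (Ioc τ t) ω :=
    (eventually_all_finset D).2 fun τ hτ => m.eventually_arrivals_gridRight
      (show τ ∈ m.post i ω ∩ Icc 0 t from hD ▸ hτ).2 ht h
  refine tendsto_const_nhds.congr' ?_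
  filter_upwards [hev] with n hn
  rw [m.gridPosts_eq_sum D hD, m.topPosts_eq_sum D hD]
  exact Finset.sum_congr rfl fun τ hτ => by rw [hn τ hτ]

lemma gridPosts_le {n : ℕ} {t : ℝ} (ht : t ≤ T) (hi : i ∈ s)
    (h : m.arrivals j s (Icc 0 T) ω < ⊤) :
    m.gridPosts K n i j s t ω ≤ (pointCount (m.post i) (Icc 0 t) ω : ℝ≥0∞) := by
  obtain ⟨D, hD⟩ := m.exists_finset_posts ht hi h
  rw [m.gridPosts_eq_sum D hD, pointCount, ← hD, encard_coe_eq_coe_finsetCard, ENat.toENNReal_coe,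
    Finset.card_eq_sum_ones, Nat.cast_sum]
  refine Finset.sum_le_sum fun τ _ => ?_
  split_ifs <;> simp

lemma measurable_gridPosts {n : ℕ} {t : ℝ} (ht : t ≤ T) (hs : s ⊆ m.bc) (hi : i ∈ s) :
    Measurable (m.gridPosts K n i j s t) := by
  refine Measurable.tsum fun k => Measurable.mul ?_ ?_
  · exact (by fun_prop : Measurable fun x : ℕ∞ => (x : ℝ≥0∞)).comp
      ((m.post_poisson i (hs hi)).measurable_count _ (measurableSet_gridCell n t k)
        ((gridCell_subset n t k).trans (Icc_subset_Icc_right ht)))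
  · exact measurable_one.indicator (m.measurable_arrivals measurableSet_Ioc
      (Ioc_grid_subset ht) hs (MeasurableSet.of_discrete (s := Iio (K : ℕ∞))))

/-- On outcomes with finitely many arrivals, `topPosts` is right-continuous in time. -/
lemma eventually_topPosts_gridRight {t : ℝ} (ht : t ∈ Icc 0 T) (hi : i ∈ s)
    (h : m.arrivals j s (Icc 0 T) ω < ⊤) :
    ∀ᶠ n in atTop, m.topPosts K i j s (min T (gridRight n t)) ω = m.topPosts K i j s t ω := by
  have hlim : Tendsto (fun n => min T (gridRight n t)) atTop (𝓝 t) := by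
    simpa [ht.2] using (tendsto_const_nhds (x := T)).min (tendsto_gridRight ht.1)
  filter_upwards [hlim.eventually (m.eventually_arrivals_Ioc_eq_zero ht.1 h)] with n hn
  have hle : t ≤ min T (gridRight n t) := le_min ht.2 (lt_gridRight n t).le
  set u := min T (gridRight n t)
  have h0 := hn (min_le_left _ _)
  have hpost : pointCount (m.post i) (Ioc t u) ω = 0 :=
    le_antisymm ((m.pointCount_post_le_arrivals hi _).trans h0.le) zero_le
  rw [pointCount_eq_zero, eq_empty_iff_forall_notMem] at hpost
  unfold topPosts
  congr 1
  ext τ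
  simp only [mem_ofPred_eq]
  refine and_congr_right fun hτ => ⟨fun hh => ?_, fun hh => ?_⟩
  · have hτt : τ ≤ t := not_lt.1 fun hlt => hpost τ ⟨hτ, hlt, hh.1.2⟩
    refine ⟨⟨hh.1.1, hτt⟩, ?_⟩
    have := hh.2
    rwa [m.arrivals_Ioc_add hτt hle, h0, add_zero] at this
  · refine ⟨⟨hh.1.1, hh.1.2.trans hle⟩, ?_⟩
    rw [m.arrivals_Ioc_add hh.1.2 hle, h0, add_zero]
    exact hh.2

lemma ae_arrivals_lt_top [IsProbabilityMeasure P] (hs : ∀ k ∈ s, (k, j) ∈ m.cand) :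
    ∀ᵐ ω ∂P, m.arrivals j s (Icc 0 T) ω < ⊤ :=
  (m.hasPoissonLaw_arrivals measurableSet_Icc subset_rfl hs).ae_lt_top

lemma aemeasurable_topPosts [IsProbabilityMeasure P] {t : ℝ} (ht : t ≤ T)
    (hs : ∀ k ∈ s, (k, j) ∈ m.cand) (hi : i ∈ s) :
    AEMeasurable (fun ω => (m.topPosts K i j s t ω : ℝ≥0∞)) P := by
  have hbc : s ⊆ m.bc := fun k hk => m.source_mem _ (hs k hk)
  refine aemeasurable_of_tendsto_metrizable_ae atTop
    (fun n => (m.measurable_gridPosts (K := K) (n := n) (j := j) ht hbc hi).aemeasurable) ?_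
  filter_upwards [m.ae_arrivals_lt_top hs] with ω hω using m.tendsto_gridPosts ht hi hω

/-- Right-continuity in time reduces joint measurability to countably many times. -/
lemma aemeasurable_uncurry_topPosts [IsProbabilityMeasure P]
    (hs : ∀ k ∈ s, (k, j) ∈ m.cand) (hi : i ∈ s) {t₀ : ℝ} (ht₀ : 0 ≤ t₀) :
    AEMeasurable (Function.uncurry fun (t : ℝ) (ω : Ω) => (m.topPosts K i j s t ω : ℝ≥0∞))
      ((volume.restrict (Icc t₀ T)).prod P) := by
  -- a measurable modification at each of the countably many grid times
  have hmod : ∀ n k : ℕ, ∃ f : Ω → ℝ≥0∞, Measurable f ∧ ∀ᵐ ω ∂P,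
      (m.topPosts K i j s (min T (((k : ℝ) + 1) / ((n : ℝ) + 1))) ω : ℝ≥0∞) = f ω := fun n k => by
    obtain ⟨f, hf, hfe⟩ := m.aemeasurable_topPosts (K := K)
      (min_le_left T (((k : ℝ) + 1) / ((n : ℝ) + 1))) hs hi
    exact ⟨f, hf, hfe⟩
  choose f hf hfe using hmod
  have hfm : ∀ n, Measurable fun p : ℝ × Ω => f n ⌊((n : ℝ) + 1) * p.1⌋₊ p.2 := fun n => by
    have : Measurable fun p : ℕ × Ω => f n p.1 p.2 :=
      measurable_from_prod_countable_right fun k => hf n k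
    exact this.comp (((measurable_floor_mul n).comp measurable_fst).prodMk measurable_snd)
  refine aemeasurable_of_tendsto_metrizable_ae atTop (fun n => (hfm n).aemeasurable) ?_
  have h1 : ∀ᵐ ω ∂P, (m.arrivals j s (Icc 0 T) ω < ⊤) ∧ ∀ n k : ℕ,
      (m.topPosts K i j s (min T (((k : ℝ) + 1) / ((n : ℝ) + 1))) ω : ℝ≥0∞) = f n k ω :=
    (m.ae_arrivals_lt_top hs).and (ae_all_iff.2 fun n => ae_all_iff.2 fun k => hfe n k)
  have h2 : ∀ᵐ t ∂(volume.restrict (Icc t₀ T)), t ∈ Icc t₀ T :=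
    ae_restrict_mem measurableSet_Icc
  filter_upwards [Measure.quasiMeasurePreserving_fst.ae h2,
    Measure.quasiMeasurePreserving_snd.ae h1] with p hp hp'
  have hev := m.eventually_topPosts_gridRight (K := K) ⟨ht₀.trans hp.1, hp.2⟩ hi hp'.1
  refine tendsto_const_nhds.congr' ?_
  filter_upwards [hev] with n hn
  rw [← hp'.2, Function.uncurry, ← hn]
  rfl

end FeedModel

namespace FeedModel

variable {V : Type*} [Fintype V] [DecidableEq V] {Ω : Type*} [MeasurableSpace Ω]
  {P : Measure Ω} {T : ℝ} (m : FeedModel V P T) {j : V} {s : Finset V} {K : ℕ} {i : V}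

/-! ### The expected number of visible posts -/

lemma integrableOn_sum_mu {s : Finset V} (hs : s ⊆ m.bc) :
    IntegrableOn (fun x => ∑ i ∈ s, m.mu i x) (Icc 0 T) :=
  integrable_finsetSum _ fun i hi => (m.mu_intensity i (hs hi)).integrable

lemma sum_mu_nonneg {s : Finset V} (hs : s ⊆ m.bc) {x : ℝ} (hx : x ∈ Icc 0 T) :
    0 ≤ ∑ i ∈ s, m.mu i x :=
  Finset.sum_nonneg fun i hi => (m.mu_intensity i (hs hi)).nonneg x hx

lemma arrivalIntensity_isIntensity (hs : s ⊆ m.bc) :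
    IsIntensity T (m.arrivalIntensity j s) where
  nonneg x hx := add_nonneg ((m.gamma_intensity j).nonneg x hx) (m.sum_mu_nonneg hs hx)
  integrable := (m.gamma_intensity j).integrable.add (m.integrableOn_sum_mu hs)

lemma lintegral_gridPosts [IsProbabilityMeasure P] {n : ℕ} {t : ℝ} (ht : t ≤ T)
    (hs : ∀ k ∈ s, (k, j) ∈ m.cand) (hi : i ∈ s) :
    ∫⁻ ω, m.gridPosts K n i j s t ω ∂P =
      ∫⁻ τ in Icc 0 t, ENNReal.ofReal (m.mu i τ) * ENNReal.ofReal
        (poissonBelow K (∫ x in Ioc (gridRight n τ) t, m.arrivalIntensity j s x)) := by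
  have hbc : s ⊆ m.bc := fun k hk => m.source_mem _ (hs k hk)
  have hmu := m.mu_intensity i (hbc hi)
  have hcT : ∀ k, gridCell n t k ⊆ Icc 0 T := fun k =>
    (gridCell_subset n t k).trans (Icc_subset_Icc_right ht)
  have hcount := fun k => (m.post_poisson i (hbc hi)).measurable_count _
    (measurableSet_gridCell n t k) (hcT k)
  have hcast : Measurable fun x : ℕ∞ => (x : ℝ≥0∞) := by fun_prop
  have hset : ∀ k : ℕ, MeasurableSet
      {ω | m.arrivals j s (Ioc (((k : ℝ) + 1) / ((n : ℝ) + 1)) t) ω < (K : ℕ∞)} := fun k =>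
    m.measurable_arrivals measurableSet_Ioc (Ioc_grid_subset ht) hbc
      (MeasurableSet.of_discrete (s := Iio (K : ℕ∞)))
  have hterm : ∀ k : ℕ, AEMeasurable (fun ω =>
      (pointCount (m.post i) (gridCell n t k) ω : ℝ≥0∞) *
      {ω | m.arrivals j s (Ioc (((k : ℝ) + 1) / ((n : ℝ) + 1)) t) ω < (K : ℕ∞)}.indicator 1 ω) P :=
    fun k => ((hcast.comp (hcount k)).mul (measurable_one.indicator (hset k))).aemeasurable
  unfold gridPosts
  rw [lintegral_tsum hterm, ← iUnion_gridCell n t, lintegral_iUnion (measurableSet_gridCell n t)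
      (pairwise_disjoint_gridCell n t)]
  congr 1
  funext k
  have hind := (m.indepFun_pointCount_arrivals (measurableSet_gridCell n t k) (hcT k)
    measurableSet_Ioc (Ioc_grid_subset ht) (disjoint_gridCell_Ioc n t k) hs hi).comp
    (φ := fun x : ℕ∞ => (x : ℝ≥0∞))
    (ψ := (Iio (K : ℕ∞)).indicator (1 : ℕ∞ → ℝ≥0∞)) hcast
    (measurable_one.indicator MeasurableSet.of_discrete)
  have hprod := lintegral_mul_eq_lintegral_mul_lintegral_of_indepFun (μ := P)
    (f := fun ω => (pointCount (m.post i) (gridCell n t k) ω : ℝ≥0∞))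
    (g := {ω | m.arrivals j s (Ioc (((k : ℝ) + 1) / ((n : ℝ) + 1)) t) ω < (K : ℕ∞)}.indicator 1)
    (hcast.comp (hcount k)) (measurable_one.indicator (hset k)) hind
  refine hprod.trans ?_
  rw [lintegral_indicator_one (hset k), ((m.post_poisson i (hbc hi)).hasPoissonLaw
    (measurableSet_gridCell n t k) (hcT k)).lintegral,
    (m.hasPoissonLaw_arrivals measurableSet_Ioc (Ioc_grid_subset ht) hs).measure_lt,
    Real.coe_toNNReal _ (setIntegral_nonneg measurableSet_Ioc fun x hx =>
      (m.arrivalIntensity_isIntensity (j := j) hbc).nonneg x (Ioc_grid_subset ht hx)),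
    ← ENNReal.ofReal, ofReal_integral_eq_lintegral_ofReal (hmu.integrable.mono_set (hcT k))
      (ae_restrict_of_forall_mem (measurableSet_gridCell n t k)
        fun x hx => hmu.nonneg x (hcT k hx)),
    ← lintegral_mul_const' _ _ ENNReal.ofReal_ne_top]
  exact setLIntegral_congr_fun (measurableSet_gridCell n t k) fun τ hτ => by
    simp only [gridRight_of_mem hτ]

lemma _root_.IsIntensity.intervalIntegrable {lam : ℝ → ℝ} (h : IsIntensity T lam) {t : ℝ}
    (ht : t ∈ Icc 0 T) : IntervalIntegrable lam volume 0 t :=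
  (intervalIntegrable_iff_integrableOn_Icc_of_le ht.1).2
    (h.integrable.mono_set (Icc_subset_Icc_right ht.2))

/-- Campbell's formula for the visible posts. The later arrivals include later posts of `i`
itself, so that the grid is needed to separate a post from what comes after it. -/
lemma lintegral_topPosts [IsProbabilityMeasure P] {t : ℝ} (ht : t ∈ Icc 0 T)
    (hs : ∀ k ∈ s, (k, j) ∈ m.cand) (hi : i ∈ s) :
    ∫⁻ ω, (m.topPosts K i j s t ω : ℝ≥0∞) ∂P =
      ENNReal.ofReal (visibleMean (poissonBelow K) (m.mu i) (m.arrivalIntensity j s) t) := by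
  have hbc : s ⊆ m.bc := fun k hk => m.source_mem _ (hs k hk)
  have hmu := m.mu_intensity i (hbc hi)
  have hlam := m.arrivalIntensity_isIntensity (j := j) hbc
  have hsub : Icc 0 t ⊆ Icc 0 T := Icc_subset_Icc_right ht.2
  have hmean : ∀ A : Set ℝ, MeasurableSet A → A ⊆ Icc 0 T →
      0 ≤ ∫ x in A, m.arrivalIntensity j s x := fun A hA hAT =>
    setIntegral_nonneg hA fun x hx => hlam.nonneg x (hAT hx)
  have hgrid : ∀ (n : ℕ) (τ : ℝ), Ioc (gridRight n τ) t ⊆ Icc 0 T := fun n τ =>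
    Ioc_grid_subset ht.2
  -- the discretized counts converge in mean
  have lim1 : Tendsto (fun n => ∫⁻ ω, m.gridPosts K n i j s t ω ∂P) atTop
      (𝓝 (∫⁻ ω, (m.topPosts K i j s t ω : ℝ≥0∞) ∂P)) := by
    refine tendsto_lintegral_of_dominated_convergence
      (fun ω => (pointCount (m.post i) (Icc 0 t) ω : ℝ≥0∞))
      (fun n => m.measurable_gridPosts ht.2 hbc hi) (fun n => ?_) ?_ ?_
    · filter_upwards [m.ae_arrivals_lt_top hs] with ω hω using m.gridPosts_le ht.2 hi hω
    · rw [((m.post_poisson i (hbc hi)).hasPoissonLaw measurableSet_Icc hsub).lintegral]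
      exact ENNReal.coe_ne_top
    · filter_upwards [m.ae_arrivals_lt_top hs] with ω hω using m.tendsto_gridPosts ht.2 hi hω
  have hcont : ContinuousOn (fun τ => ∫ x in τ..t, m.arrivalIntensity j s x) (Icc 0 t) := by
    have := continuousOn_integral_tail (hlam.intervalIntegrable ht)
    rwa [uIcc_of_le ht.1] at this
  have lim2 : Tendsto (fun n => ∫⁻ ω, m.gridPosts K n i j s t ω ∂P) atTop
      (𝓝 (∫⁻ τ in Icc 0 t, ENNReal.ofReal (m.mu i τ) * ENNReal.ofReal
        (poissonBelow K (∫ x in τ..t, m.arrivalIntensity j s x)))) := by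
    simp_rw [m.lintegral_gridPosts ht.2 hs hi]
    refine tendsto_lintegral_of_dominated_convergence' (fun τ => ENNReal.ofReal (m.mu i τ))
      (fun n => ?_) (fun n => ae_of_all _ fun τ => ?_) ?_ ?_
    · refine (hmu.integrable.mono_set hsub).aemeasurable.ennreal_ofReal.mul
        (Measurable.aemeasurable ?_)
      exact (measurable_from_nat (f := fun k : ℕ => ENNReal.ofReal (poissonBelow K
        (∫ x in Ioc (((k : ℝ) + 1) / ((n : ℝ) + 1)) t, m.arrivalIntensity j s x)))).comp
        (measurable_floor_mul n)
    · refine mul_le_of_le_one_right zero_le ?_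
      rw [← ENNReal.ofReal_one]
      exact ENNReal.ofReal_le_ofReal
        (poissonBelow_le_one K (hmean _ measurableSet_Ioc (hgrid n τ)))
    · rw [← ofReal_integral_eq_lintegral_ofReal (hmu.integrable.mono_set hsub)
        (ae_restrict_of_forall_mem measurableSet_Icc fun x hx => hmu.nonneg x (hsub hx))]
      exact ENNReal.ofReal_ne_top
    · refine ae_restrict_of_forall_mem measurableSet_Icc fun τ hτ => ?_
      refine ENNReal.Tendsto.const_mul (ENNReal.tendsto_ofReal ?_) (Or.inr ENNReal.ofReal_ne_top)
      refine ((continuous_poissonBelow K).tendsto _).comp ?_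
      have hlim : Tendsto (fun n => min t (gridRight n τ)) atTop (𝓝[Icc 0 t] τ) := by
        refine tendsto_nhdsWithin_iff.2 ⟨?_, Eventually.of_forall fun n =>
          ⟨le_min ht.1 (hτ.1.trans (lt_gridRight n τ).le), min_le_left _ _⟩⟩
        simpa [hτ.2] using (tendsto_const_nhds (x := t)).min (tendsto_gridRight hτ.1)
      refine ((hcont τ hτ).tendsto.comp hlim).congr fun n => ?_
      rw [Function.comp_apply, intervalIntegral.integral_of_le (min_le_left _ _)]
      rcases le_total t (gridRight n τ) with h | h
      · rw [min_eq_left h, Ioc_self, Ioc_eq_empty h.not_gt]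
      · rw [min_eq_right h]
  rw [tendsto_nhds_unique lim1 lim2, visibleMean, intervalIntegral.integral_of_le ht.1,
    ← integral_Icc_eq_integral_Ioc, ofReal_integral_eq_lintegral_ofReal]
  · refine setLIntegral_congr_fun measurableSet_Icc fun τ hτ => ?_
    exact (ENNReal.ofReal_mul (hmu.nonneg τ (hsub hτ))).symm
  · exact (intervalIntegrable_iff_integrableOn_Icc_of_le ht.1).1 (intervalIntegrable_mul_comp_tail
      (continuous_poissonBelow K) (hmu.intervalIntegrable ht) (hlam.intervalIntegrable ht))
  · refine ae_restrict_of_forall_mem measurableSet_Icc fun τ hτ => ?_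
    exact mul_nonneg (hmu.nonneg τ (hsub hτ)) (poissonBelow_nonneg K
      (integral_tail_nonneg hτ fun x hx => hlam.nonneg x (hsub hx)))

lemma visibleMean_mu_nonneg (hs : s ⊆ m.bc) (hi : i ∈ s) {t : ℝ} (ht : t ∈ Icc 0 T) :
    0 ≤ visibleMean (poissonBelow K) (m.mu i) (m.arrivalIntensity j s) t := by
  refine intervalIntegral.integral_nonneg ht.1 fun τ hτ => ?_
  have hsub : Icc 0 t ⊆ Icc 0 T := Icc_subset_Icc_right ht.2
  exact mul_nonneg ((m.mu_intensity i (hs hi)).nonneg τ (hsub hτ)) (poissonBelow_nonneg K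
    (integral_tail_nonneg hτ fun x hx => (m.arrivalIntensity_isIntensity hs).nonneg x (hsub hx)))

lemma visibleMean_mu_le (hs : s ⊆ m.bc) (hi : i ∈ s) {t : ℝ} (ht : t ∈ Icc 0 T) :
    visibleMean (poissonBelow K) (m.mu i) (m.arrivalIntensity j s) t ≤
      ∫ x in Icc 0 T, m.mu i x := by
  have hmu := m.mu_intensity i (hs hi)
  have hlam := m.arrivalIntensity_isIntensity (j := j) hs
  have hsub : Icc 0 t ⊆ Icc 0 T := Icc_subset_Icc_right ht.2
  have h1 : visibleMean (poissonBelow K) (m.mu i) (m.arrivalIntensity j s) t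
      ≤ ∫ x in (0 : ℝ)..t, m.mu i x := by
    refine intervalIntegral.integral_mono_on ht.1 (intervalIntegrable_mul_comp_tail
      (continuous_poissonBelow K) (hmu.intervalIntegrable ht) (hlam.intervalIntegrable ht))
      (hmu.intervalIntegrable ht) fun τ hτ => ?_
    exact mul_le_of_le_one_right (hmu.nonneg τ (hsub hτ)) (poissonBelow_le_one K
      (integral_tail_nonneg hτ fun x hx => hlam.nonneg x (hsub hx)))
  refine h1.trans ?_
  rw [intervalIntegral.integral_of_le ht.1, ← integral_Icc_eq_integral_Ioc]
  exact setIntegral_mono_set hmu.integrable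
    (ae_restrict_of_forall_mem measurableSet_Icc fun x hx => hmu.nonneg x hx) hsub.eventuallyLE

lemma integrableOn_visibleMean_mu [IsProbabilityMeasure P] (hs : ∀ k ∈ s, (k, j) ∈ m.cand)
    (hi : i ∈ s) {t₀ : ℝ} (ht₀ : 0 ≤ t₀) :
    IntegrableOn (visibleMean (poissonBelow K) (m.mu i) (m.arrivalIntensity j s)) (Icc t₀ T) := by
  have hbc : s ⊆ m.bc := fun k hk => m.source_mem _ (hs k hk)
  have hsub : Icc t₀ T ⊆ Icc 0 T := Icc_subset_Icc_left ht₀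
  have hmeas : AEMeasurable (visibleMean (poissonBelow K) (m.mu i) (m.arrivalIntensity j s))
      (volume.restrict (Icc t₀ T)) := by
    have hjoint := m.aemeasurable_uncurry_topPosts (K := K) hs hi ht₀
    refine hjoint.lintegral_prod_right'.ennreal_toReal.congr
      (ae_restrict_of_forall_mem measurableSet_Icc fun t ht => ?_)
    simp only [Function.uncurry]
    rw [m.lintegral_topPosts (hsub ht) hs hi,
      ENNReal.toReal_ofReal (m.visibleMean_mu_nonneg hbc hi (hsub ht))]
  refine Integrable.mono' (g := fun _ => ∫ x in Icc 0 T, m.mu i x)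
    (integrable_const _) hmeas.aestronglyMeasurable
    (ae_restrict_of_forall_mem measurableSet_Icc fun t ht => ?_)
  rw [Real.norm_of_nonneg (m.visibleMean_mu_nonneg hbc hi (hsub ht))]
  exact m.visibleMean_mu_le hbc hi (hsub ht)

lemma gained_cand {L : Finset (V × V)} (hL : L ⊆ m.cand) :
    ∀ k ∈ m.gained L j, (k, j) ∈ m.cand := fun _ hk => hL (Finset.mem_filter.1 hk).2

lemma linkVisibility_eq [IsProbabilityMeasure P] {L : Finset (V × V)} (hL : L ⊆ m.cand)
    (hi : i ∈ m.gained L j) {t₀ : ℝ} (ht₀ : 0 ≤ t₀) :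
    m.linkVisibility K t₀ L i j =
      ∫ t in Icc t₀ T, visibleMean (poissonBelow K) (m.mu i) (m.feedIntensity L j) t := by
  have hs := m.gained_cand (j := j) hL
  have hbc : m.gained L j ⊆ m.bc := Finset.filter_subset _ _
  have hsub : Icc t₀ T ⊆ Icc 0 T := Icc_subset_Icc_left ht₀
  have hswap := lintegral_lintegral_swap (m.aemeasurable_uncurry_topPosts (K := K) hs hi ht₀)
  rw [setLIntegral_congr_fun measurableSet_Icc fun t ht =>
    m.lintegral_topPosts (K := K) (hsub ht) hs hi,
    ← ofReal_integral_eq_lintegral_ofReal (m.integrableOn_visibleMean_mu hs hi ht₀)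
      (ae_restrict_of_forall_mem measurableSet_Icc fun t ht =>
        m.visibleMean_mu_nonneg hbc hi (hsub ht))] at hswap
  change (∫⁻ ω, (∫⁻ t in Icc t₀ T, (m.topPosts K i j (m.gained L j) t ω : ℝ≥0∞)) ∂P).toReal = _
  rw [← hswap, ENNReal.toReal_ofReal]
  · rfl
  · exact setIntegral_nonneg measurableSet_Icc fun t ht =>
      m.visibleMean_mu_nonneg hbc hi (hsub ht)

/-- The expected visibility that the links `L` bring with respect to `j`. -/
lemma sum_linkVisibility_eq [IsProbabilityMeasure P] {L : Finset (V × V)} (hL : L ⊆ m.cand)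
    {t₀ : ℝ} (ht₀ : 0 ≤ t₀) :
    IntegrableOn (visibleMean (poissonBelow K) (fun x => ∑ i ∈ m.gained L j, m.mu i x)
      (m.feedIntensity L j)) (Icc t₀ T) ∧
    ∑ i ∈ m.gained L j, m.linkVisibility K t₀ L i j =
      ∫ t in Icc t₀ T, visibleMean (poissonBelow K) (fun x => ∑ i ∈ m.gained L j, m.mu i x)
        (m.feedIntensity L j) t := by
  have hs := m.gained_cand (j := j) hL
  have hbc : m.gained L j ⊆ m.bc := Finset.filter_subset _ _
  have hint : ∀ i ∈ m.gained L j, IntegrableOn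
      (visibleMean (poissonBelow K) (m.mu i) (m.feedIntensity L j)) (Icc t₀ T) :=
    fun i hi => m.integrableOn_visibleMean_mu hs hi ht₀
  have hsum : ∀ t ∈ Icc t₀ T, ∑ i ∈ m.gained L j,
      visibleMean (poissonBelow K) (m.mu i) (m.feedIntensity L j) t =
      visibleMean (poissonBelow K) (fun x => ∑ i ∈ m.gained L j, m.mu i x)
        (m.feedIntensity L j) t := fun t ht => by
    have ht' : t ∈ Icc 0 T := ⟨ht₀.trans ht.1, ht.2⟩
    have hfeed : IntervalIntegrable (m.feedIntensity L j) volume 0 t :=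
      (m.arrivalIntensity_isIntensity hbc).intervalIntegrable ht'
    simp only [visibleMean, Finset.sum_mul]
    rw [intervalIntegral.integral_finsetSum fun i hi => intervalIntegrable_mul_comp_tail
      (continuous_poissonBelow K) ((m.mu_intensity i (hbc hi)).intervalIntegrable ht') hfeed]
  refine ⟨(integrable_finsetSum _ hint).congr
    (ae_restrict_of_forall_mem measurableSet_Icc hsum), ?_⟩
  rw [Finset.sum_congr rfl fun i hi => m.linkVisibility_eq hL hi ht₀, ← integral_finsetSum _ hint]
  exact setIntegral_congr_fun measurableSet_Icc hsum

end FeedModel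

/-! ### Consequences of `ξ`-boundedness -/

lemma IsXiBounded.one_le {T ξ : ℝ} {lam : ℝ → ℝ} (h : IsXiBounded T ξ lam)
    {s : ℝ} (hs : s ∈ Ioo 0 T) (hpos : 0 < lam s) : 1 ≤ ξ := by
  have := h s hs s hs
  by_contra! hlt
  nlinarith

/-- If `f ≤ g` are `ξ`-bounded, the share of `f` in `g` varies by a factor of at most `ξ ^ 2`: the
lower bound `inf f / sup g` serves. -/
lemma IsXiBounded.exists_share {T ξ : ℝ} {f g : ℝ → ℝ} (hf : IsXiBounded T ξ f)
    (hg : IsXiBounded T ξ g) (hf0 : ∀ x ∈ Ioo 0 T, 0 ≤ f x) (hfg : ∀ x ∈ Ioo 0 T, f x ≤ g x)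
    {s : ℝ} (hs : s ∈ Ioo 0 T) (hpos : 0 < f s) :
    ∃ k, 0 ≤ k ∧ k ≤ 1 ∧ (∀ x ∈ Ioo 0 T, k * g x ≤ f x) ∧
      ∀ x ∈ Ioo 0 T, f x ≤ ξ ^ 2 * k * g x := by
  have hξ : 0 < ξ := zero_lt_one.trans_le (hf.one_le hs hpos)
  set a := sInf (f '' Ioo 0 T)
  set b := sSup (g '' Ioo 0 T)
  have hbdd : BddAbove (g '' Ioo 0 T) := ⟨ξ * g s, forall_mem_image.2 fun x hx => hg x hx s hs⟩
  have hbdd' : BddBelow (f '' Ioo 0 T) := ⟨0, forall_mem_image.2 hf0⟩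
  have hgb : ∀ x ∈ Ioo 0 T, g x ≤ b := fun x hx => le_csSup hbdd (mem_image_of_mem g hx)
  have haf : ∀ x ∈ Ioo 0 T, a ≤ f x := fun x hx => csInf_le hbdd' (mem_image_of_mem f hx)
  have ha0 : 0 ≤ a := le_csInf ⟨_, mem_image_of_mem f hs⟩ (forall_mem_image.2 hf0)
  have hfa : ∀ x ∈ Ioo 0 T, f x ≤ ξ * a := fun x hx => by
    rw [← div_le_iff₀' hξ]
    refine le_csInf ⟨_, mem_image_of_mem f hs⟩ (forall_mem_image.2 fun t ht => ?_)
    rw [div_le_iff₀' hξ]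
    exact hf x hx t ht
  have hbg : ∀ x ∈ Ioo 0 T, b ≤ ξ * g x := fun x hx =>
    csSup_le ⟨_, mem_image_of_mem g hs⟩ (forall_mem_image.2 fun t ht => hg t ht x hx)
  have hb : 0 < b := hpos.trans_le ((hfg s hs).trans (hgb s hs))
  have hk0 : 0 ≤ a / b := div_nonneg ha0 hb.le
  have hab : a / b * b = a := div_mul_cancel₀ a hb.ne'
  refine ⟨a / b, hk0, ?_, fun x hx => ?_, fun x hx => ?_⟩
  · rw [div_le_one hb]
    exact (haf s hs).trans ((hfg s hs).trans (hgb s hs))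
  · have := mul_le_mul_of_nonneg_left (hgb x hx) hk0
    linarith [haf x hx]
  · have := mul_le_mul_of_nonneg_left (hbg x hx) (mul_nonneg hξ.le hk0)
    calc f x ≤ ξ * a := hfa x hx
      _ = ξ * (a / b) * b := by rw [mul_assoc, hab]
      _ ≤ ξ * (a / b) * (ξ * g x) := this
      _ = ξ ^ 2 * (a / b) * g x := by ring

lemma le_theta₂ {ξ ζ ρ : ℝ} (hξ : 0 ≤ ξ) (hζ : 4 * Real.exp (7 / 4) < ζ) (hρ : 0 < ρ) :
    ξ ≤ theta₂ ξ ζ ρ := by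
  have hζ0 : 0 < ζ := lt_trans (by positivity) hζ
  have h1 : 0 < 1 - 4 * Real.exp (7 / 4) / ζ := by rwa [sub_pos, div_lt_one hζ0]
  have h1' : 1 - 4 * Real.exp (7 / 4) / ζ ≤ 1 := sub_le_self _ (by positivity)
  have h2 : 0 < min ρ 1 := lt_min hρ one_pos
  have h3 : Real.exp (-(1 / ρ ^ 2)) ≤ 1 := Real.exp_le_one_iff.2 (by simpa using sq_nonneg ρ)
  have hD : 0 < (1 - 4 * Real.exp (7 / 4) / ζ) * min ρ 1 * Real.exp (-(1 / ρ ^ 2)) := by positivity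
  have hD1 : (1 - 4 * Real.exp (7 / 4) / ζ) * min ρ 1 * Real.exp (-(1 / ρ ^ 2)) ≤ 1 :=
    mul_le_one₀ (mul_le_one₀ h1' h2.le (min_le_right _ _)) (Real.exp_pos _).le h3
  have he : 1 ≤ Real.exp (7 / 4) := Real.one_le_exp (by norm_num)
  have hc : 1 ≤ 2 * Real.exp (7 / 4) /
      ((1 - 4 * Real.exp (7 / 4) / ζ) * min ρ 1 * Real.exp (-(1 / ρ ^ 2))) := by
    rw [one_le_div hD]
    linarith
  have := mul_le_mul_of_nonneg_right hc hξ
  rw [theta₂]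
  linarith

namespace FeedModel

variable {V : Type*} [Fintype V] [DecidableEq V] {Ω : Type*} [MeasurableSpace Ω]
  {P : Measure Ω} {T : ℝ} (m : FeedModel V P T) {K : ℕ} {i j : V} {t₀ : ℝ}

/-! ### Marginal gains of the visibility -/

lemma gained_union_self {L : Finset (V × V)} (hv : (i, j) ∈ m.cand) :
    m.gained (L ∪ {(i, j)}) j = insert i (m.gained L j) := by
  ext k
  have := m.source_mem _ hv
  simp only [gained, Finset.mem_filter, Finset.mem_union, Finset.mem_singleton, Prod.mk.injEq,
    and_true, Finset.mem_insert]
  grind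

lemma gained_union_of_ne {L : Finset (V × V)} {l : V} (h : l ≠ j) :
    m.gained (L ∪ {(i, j)}) l = m.gained L l := by
  ext k
  simp [gained, h]

lemma linkVisibility_congr {L L' : Finset (V × V)} {l k : V} (h : m.gained L l = m.gained L' l) :
    m.linkVisibility K t₀ L k l = m.linkVisibility K t₀ L' k l := by
  simp only [linkVisibility, topCount, feedCount, h]

lemma marginalGain_visibility_of_mem {L : Finset (V × V)} {v : V × V} (hv : v ∈ L) :
    marginalGain (m.visibility K t₀) v L = 0 := by
  rw [marginalGain, Finset.union_eq_left.2 (Finset.singleton_subset_iff.2 hv), sub_self]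

lemma marginalGain_visibility [IsProbabilityMeasure P] (ht₀ : 0 ≤ t₀) {L : Finset (V × V)}
    (hL : L ⊆ m.cand) (hv : (i, j) ∈ m.cand) (hvL : (i, j) ∉ L) :
    IntegrableOn (visibleGain (poissonBelow K) (m.gamma j)
      (fun x => ∑ k ∈ m.gained L j, m.mu k x) (m.mu i)) (Icc t₀ T) ∧
    marginalGain (m.visibility K t₀) (i, j) L =
      ∫ t in Icc t₀ T, visibleGain (poissonBelow K) (m.gamma j)
        (fun x => ∑ k ∈ m.gained L j, m.mu k x) (m.mu i) t := by
  have hL' : L ∪ {(i, j)} ⊆ m.cand := Finset.union_subset hL (Finset.singleton_subset_iff.2 hv)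
  have hi : i ∉ m.gained L j := fun h => hvL (Finset.mem_filter.1 h).2
  have hj : j ∈ m.candUsers :=
    Finset.mem_union_right _ (Finset.mem_image_of_mem Prod.snd hv)
  obtain ⟨int1, eq1⟩ := m.sum_linkVisibility_eq (K := K) (j := j) hL ht₀
  obtain ⟨int2, eq2⟩ := m.sum_linkVisibility_eq (K := K) (j := j) hL' ht₀
  have hmu : (fun x => ∑ k ∈ m.gained (L ∪ {(i, j)}) j, m.mu k x)
      = fun x => ∑ k ∈ m.gained L j, m.mu k x + m.mu i x := by
    funext x
    rw [m.gained_union_self hv, Finset.sum_insert hi, add_comm]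
  have hfeed : m.feedIntensity (L ∪ {(i, j)}) j
      = fun x => m.gamma j x + ∑ k ∈ m.gained L j, m.mu k x + m.mu i x := by
    funext x
    rw [feedIntensity, m.gained_union_self hv, Finset.sum_insert hi]
    ring
  rw [hmu, hfeed] at int2 eq2
  refine ⟨int2.sub int1, ?_⟩
  -- only the feed of `j` changes
  have hsum : marginalGain (m.visibility K t₀) (i, j) L =
      ∑ k ∈ m.gained (L ∪ {(i, j)}) j, m.linkVisibility K t₀ (L ∪ {(i, j)}) k j -
      ∑ k ∈ m.gained L j, m.linkVisibility K t₀ L k j := by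
    rw [marginalGain, visibility, visibility, ← Finset.sum_sub_distrib]
    refine Finset.sum_eq_single_of_mem j hj fun l _ hl => ?_
    have hg := m.gained_union_of_ne (i := i) (L := L) hl
    rw [hg, sub_eq_zero]
    exact Finset.sum_congr rfl fun k _ => m.linkVisibility_congr hg
  rw [hsum, eq1, eq2, ← integral_sub int2 int1]
  rfl

lemma marginalGain_visibility_nonneg [IsProbabilityMeasure P] (ht₀ : 0 ≤ t₀)
    {L : Finset (V × V)} (hL : L ⊆ m.cand) {v : V × V} (hv : v ∈ m.cand) :
    0 ≤ marginalGain (m.visibility K t₀) v L := by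
  obtain ⟨i, j⟩ := v
  by_cases hvL : (i, j) ∈ L
  · rw [m.marginalGain_visibility_of_mem hvL]
  rw [(m.marginalGain_visibility ht₀ hL hv hvL).2]
  refine setIntegral_nonneg measurableSet_Icc fun t ht => ?_
  have ht' : t ∈ Icc 0 T := ⟨ht₀.trans ht.1, ht.2⟩
  have hsub : Icc 0 t ⊆ Icc 0 T := Icc_subset_Icc_right ht.2
  have hbc : m.gained L j ⊆ m.bc := Finset.filter_subset _ _
  have hM : IsIntensity T (fun x => ∑ k ∈ m.gained L j, m.mu k x) :=
    ⟨fun x hx => m.sum_mu_nonneg hbc hx, m.integrableOn_sum_mu hbc⟩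
  have hmu := m.mu_intensity i (m.source_mem _ hv)
  exact visibleGain_nonneg (continuous_poissonBelow K) (antitoneOn_poissonBelow K)
    (fun _ hx => poissonBelow_nonneg K hx) ht'.1 ((m.gamma_intensity j).intervalIntegrable ht')
    (hM.intervalIntegrable ht') (hmu.intervalIntegrable ht')
    (fun x hx => (m.gamma_intensity j).nonneg x (hsub hx)) (fun x hx => hM.nonneg x (hsub hx))
    fun x hx => hmu.nonneg x (hsub hx)

/-- The curvature bound in terms of `ξ` alone. -/
lemma marginalGain_visibility_le [IsProbabilityMeasure P] (ht₀ : 0 ≤ t₀) {ξ : ℝ}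
    (hξ : ∀ L : Finset (V × V), L ⊆ m.cand → ∀ j : V, IsXiBounded T ξ (m.feedIntensity L j))
    (hpos : ∀ j : V, ∃ s ∈ Ioo 0 T, 0 < m.gamma j s) {A B : Finset (V × V)} (hAB : A ⊆ B)
    (hB : B ⊆ m.cand) {v : V × V} (hv : v ∈ m.cand) :
    marginalGain (m.visibility K t₀) v B ≤ ξ ^ 2 * marginalGain (m.visibility K t₀) v A := by
  by_cases hvB : v ∈ B
  · rw [m.marginalGain_visibility_of_mem hvB]
    exact mul_nonneg (sq_nonneg ξ) (m.marginalGain_visibility_nonneg ht₀ (hAB.trans hB) hv)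
  obtain ⟨i, j⟩ := v
  obtain ⟨s, hs, hs0⟩ := hpos j
  have hA := hAB.trans hB
  obtain ⟨intA, eqA⟩ := m.marginalGain_visibility (K := K) ht₀ hA hv fun h => hvB (hAB h)
  obtain ⟨intB, eqB⟩ := m.marginalGain_visibility (K := K) ht₀ hB hv hvB
  have hgain : ∀ L : Finset (V × V), IsIntensity T (fun x => ∑ k ∈ m.gained L j, m.mu k x) :=
    fun L => ⟨fun x hx => m.sum_mu_nonneg (Finset.filter_subset _ _) hx,
      m.integrableOn_sum_mu (Finset.filter_subset _ _)⟩
  have hgam := m.gamma_intensity j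
  have hmu := m.mu_intensity i (m.source_mem _ hv)
  have hle : ∀ x ∈ Icc 0 T, ∑ k ∈ m.gained A j, m.mu k x ≤ ∑ k ∈ m.gained B j, m.mu k x :=
    fun x hx => Finset.sum_le_sum_of_subset_of_nonneg
      (Finset.monotone_filter_right _ fun _ _ h => hAB h) fun k hk _ =>
        (m.mu_intensity k (Finset.mem_filter.1 hk).1).nonneg x hx
  have hgamξ : IsXiBounded T ξ (m.gamma j) := by
    have := hξ ∅ (Finset.empty_subset _) j
    have h0 : m.feedIntensity ∅ j = m.gamma j := by
      funext x; simp [feedIntensity, gained]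
    rwa [h0] at this
  have hξ1 := hgamξ.one_le hs hs0
  obtain ⟨k, hk0, hk1, hlow, hupp⟩ := hgamξ.exists_share (hξ A hA j)
    (fun x hx => hgam.nonneg x (Ioo_subset_Icc_self hx))
    (fun x hx => le_add_of_nonneg_right ((hgain A).nonneg x (Ioo_subset_Icc_self hx))) hs hs0
  rw [eqA, eqB, ← integral_const_mul]
  refine setIntegral_mono_on intB (intA.const_mul _) measurableSet_Icc fun t ht => ?_
  have ht' : t ∈ Icc 0 T := ⟨ht₀.trans ht.1, ht.2⟩
  have hsub : Icc 0 t ⊆ Icc 0 T := Icc_subset_Icc_right ht.2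
  have hsub' : Ioo 0 t ⊆ Ioo 0 T := Ioo_subset_Ioo_right ht.2
  refine visibleGain_le_mul (continuous_poissonBelow K) (antitoneOn_poissonBelow K)
    (fun _ hx => poissonBelow_nonneg K hx) ht'.1 (hgam.intervalIntegrable ht')
    ((hgain A).intervalIntegrable ht') ((hgain B).intervalIntegrable ht')
    (hmu.intervalIntegrable ht') (fun x hx => hgam.nonneg x (hsub hx))
    (fun x hx => (hgain A).nonneg x (hsub hx)) (fun x hx => hle x (hsub hx))
    (fun x hx => hmu.nonneg x (hsub hx)) hk0 hk1 (one_le_pow₀ hξ1)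
    (fun x hx => hlow x (hsub' hx)) fun x hx => ?_
  refine (hupp x (hsub' hx)).trans (mul_le_mul_of_nonneg_left ?_ (by positivity))
  exact add_le_add_right (hle x (hsub (Ioo_subset_Icc_self hx))) _

/-- A feed that receives stories at all before `t₀` has positive intensity somewhere. -/
lemma exists_gamma_pos (ht : t₀ ∈ Icc 0 T) (h : 0 < ∫ x in (0 : ℝ)..t₀, m.gamma j x) :
    ∃ s ∈ Ioo 0 T, 0 < m.gamma j s := by
  by_contra! hle
  have : ∫ x in (0 : ℝ)..t₀, m.gamma j x ≤ ∫ _ in (0 : ℝ)..t₀, (0 : ℝ) :=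
    intervalIntegral.integral_mono_on_of_le_Ioo ht.1 ((m.gamma_intensity j).intervalIntegrable ht)
      intervalIntegrable_const fun x hx => hle x (Ioo_subset_Ioo_right ht.2 hx)
  rw [intervalIntegral.integral_zero] at this
  exact this.not_gt h

end FeedModel

end

theorem mainTheorem4 {V : Type*} [Fintype V] [DecidableEq V] {Ω : Type*} [MeasurableSpace Ω]
    (P : Measure Ω) [IsProbabilityMeasure P]
    (t₀ t_f : ℝ) (ht₀ : 0 ≤ t₀) (ht : t₀ < t_f)
    (m : FeedModel V P t_f)
    (K : ℕ) (hK : 2 ≤ K)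
    (ξ ζ ρ : ℝ) (hζ : 4 * Real.exp (7 / 4) < ζ) (hρ : 0 < ρ)
    (hξ : ∀ L : Finset (V × V), L ⊆ m.cand → ∀ j : V,
      IsXiBounded t_f ξ (m.feedIntensity L j))
    (hmain : ∀ j : V,
      (K : ℝ) - 1 + ζ * Real.sqrt ((K : ℝ) - 1) ≤ ∫ x in (0 : ℝ)..t₀, m.gamma j x)
    (hextra : ∀ t ∈ Set.Icc 0 t_f, ∀ i ∈ m.bc, ∀ j ∈ m.candUsers,
      m.mu i t ≤ m.gamma j t / (ρ * Real.sqrt ((K : ℝ) - 1))) :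
    IsAlphaSubmodular m.cand (m.visibility K t₀) (1 - 1 / (ξ * theta₂ ξ ζ ρ)) ∧
      generalizedCurvature m.cand (m.visibility K t₀) ≤
        ((1 - 1 / (ξ * theta₂ ξ ζ ρ) : ℝ) : EReal) := by
  have hpos : ∀ j : V, ∃ s ∈ Ioo 0 t_f, 0 < m.gamma j s := fun j => by
    refine m.exists_gamma_pos ⟨ht₀, ht.le⟩ (lt_of_lt_of_le ?_ (hmain j))
    have hK' : (2 : ℝ) ≤ K := by exact_mod_cast hK
    have hζ0 : 0 < ζ := lt_trans (by positivity) hζ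
    have := mul_nonneg hζ0.le (Real.sqrt_nonneg ((K : ℝ) - 1))
    linarith
  have hone : ∀ v ∈ m.cand, 1 ≤ ξ := fun v _ => by
    obtain ⟨s, hs, hs0⟩ := hpos v.2
    refine (hξ ∅ (Finset.empty_subset _) v.2).one_le hs ?_
    simpa [FeedModel.feedIntensity, FeedModel.gained] using hs0
  have hsq : ∀ v ∈ m.cand, 1 ≤ ξ ^ 2 ∧ ξ ^ 2 ≤ ξ * theta₂ ξ ζ ρ := fun v hv => by
    have h1 := hone v hv
    refine ⟨one_le_pow₀ h1, ?_⟩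
    rw [sq]
    exact mul_le_mul_of_nonneg_left (le_theta₂ (by linarith) hζ hρ) (by linarith)
  have hsub : IsAlphaSubmodular m.cand (m.visibility K t₀) (1 - 1 / (ξ * theta₂ ξ ζ ρ)) := by
    intro v hv A B hAB hB
    obtain ⟨h1, h2⟩ := hsq v hv
    have hg := m.marginalGain_visibility_le (K := K) ht₀ hξ hpos hAB hB hv
    have hg0 := m.marginalGain_visibility_nonneg (K := K) ht₀ (hAB.trans hB) hv
    rw [sub_sub_cancel, one_div_mul_eq_div, div_le_iff₀' (by linarith)]
    exact hg.trans (mul_le_mul_of_nonneg_right h2 hg0)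
  refine ⟨hsub, ?_⟩
  have hcurv : ∀ a : ℝ, a ≤ 1 → IsAlphaSubmodular m.cand (m.visibility K t₀) a →
      generalizedCurvature m.cand (m.visibility K t₀) ≤ (a : EReal) := fun a h1 h2 =>
    sInf_le (mem_image_of_mem _ ⟨h1, h2⟩)
  rcases m.cand.eq_empty_or_nonempty with hc | ⟨v, hv⟩
  · -- without candidate links nothing bounds `ξ` below, but every `a ≤ 1` is admissible
    refine (hcurv (min (1 - 1 / (ξ * theta₂ ξ ζ ρ)) 1) (min_le_right _ _) fun v hv => ?_).trans
      (EReal.coe_le_coe_iff.2 (min_le_left _ _))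
    simp [hc] at hv
  · obtain ⟨h1, h2⟩ := hsq v hv
    have : 0 ≤ 1 / (ξ * theta₂ ξ ζ ρ) := one_div_nonneg.2 (by linarith)
    exact hcurv _ (by linarith) hsub
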